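/- Let $N\ge 1$ and let $\Omega\subset\mathbb R^N$ be a nonempty bounded open set. Let $J:\mathbb R^N\setminus\{0\}\to(0,\infty)$ be measurable and even, with $J\notin L^1(B_1)$ and $\int_{\mathbb R^N}\min(1,|z|^{q_0})J(z)\,dz<\infty$ for some $q_0>0$; let $q_*\ge 0$ be the infimum of all such $q_0$. Let $p\ge q>\max\{q_*,1\}$, let $\psi:\mathbb R\to\mathbb R$ be nondecreasing, continuous, odd and unbounded, and let $\Psi:\mathbb R\to[0,\infty)$, $\Psi'=\psi$, be convex and even with $\Psi(0)=0$, $\Psi(1)=1$ and $q\le s\Psi'(s)/\Psi(s)\le p$ for all $s\ne0$. Put $$E(u)=\tfrac12\iint_{\mathbb R^{2N}}\Psi(u(x)-u(y))J(x-y)\,dx\,dy,\qquad \mathcal E(u;\varphi)=\tfrac12\iint_{\mathbb R^{2N}}\psi(u(x)-u(y))(\varphi(x)-\varphi(y))J(x-y)\,dx\,dy,$$ and let $W_0^{J,\Psi}(\Omega)$ be the set of measurable $u:\mathbb R^N\to\mathbb R$ with $\int_{\mathbb R^N}\Psi(u)<\infty$, $E(u)<\infty$ and $u=0$ a.e. in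 $\Omega^c$. **Theorem 5.1.** Let $f:[0,\infty)\to\mathbb R$ be continuous, and suppose that for some $0<\mu<\frac{q-1}{p}$ and some constants $c_1,c_2$, $$|f(t)|\le c_1+c_2\Psi^\mu(t)\quad\text{for all } t\ge0,\qquad \liminf_{t\to0^+}\frac{f(t)}{\Psi^\mu(t)}>0 .$$ Then the problem $$\mathcal Lu=f(u),\quad u\ge0,\quad u\not\equiv0\ \text{ in }\Omega,\qquad u=0\ \text{ in }\Omega^c,$$ has a weak solution $u\in W_0^{J,\Psi}(\Omega)$; that is, $u\ge0$ a.e. in $\Omega$, $u$ is not a.e. zero in $\Omega$, and for every $\varphi\in W_0^{J,\Psi}(\Omega)$ both sides of $$\mathcal E(u;\varphi)=\int_\Omega f(u)\varphi$$ converge absolutely and are equal. Moreover $u$ can be chosen to be a global minimizer with negative energy: with $G(t)=\int_0^{|t|}f(s)\,ds$ for $t\in\mathbb R$, the functional $I(v)=E(v)-\int_\Omega G(v)$ is well defined on $W_0^{J,\Psi}(\Omega)$ (that is, $G(v)\in L^1(\Omega)$), and $$I(u)=\min_{v\in W_0^{J,\Psi}(\Omega)}I(v)<0 .$$ -/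

import Mathlib

open MeasureTheory Filter Topology Set
open scoped ENNReal

noncomputable section

namespace NonlocalOrlicz

/-- `ℝ^N` with its Euclidean norm and Lebesgue measure. -/
abbrev Space (N : ℕ) : Type := EuclideanSpace ℝ (Fin N)

/-- The standing assumptions on the kernel `J`. Only the values off the origin matter, so
positivity is required there only (a singular kernel has no value at the origin). -/
structure IsKernel {N : ℕ} (J : Space N → ℝ) : Prop where
  aemeasurable : AEMeasurable J volume
  pos : ∀ z, z ≠ 0 → 0 < J z
  symm : ∀ z, J (-z) = J z
  not_integrable : ¬ IntegrableOn J (Metric.ball 0 1) volume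
  exists_moment : ∃ q₀ : ℝ, 0 < q₀ ∧ Integrable (fun z => min 1 (‖z‖ ^ q₀) * J z) volume

/-- The exponent `q_*`, the infimum of the `q₀ > 0` with `∫ min(1, |z|^q₀) J(z) dz < ∞`. -/
def qStar {N : ℕ} (J : Space N → ℝ) : ℝ :=
  sInf {q₀ : ℝ | 0 < q₀ ∧ Integrable (fun z => min 1 (‖z‖ ^ q₀) * J z) volume}

/-- The standing assumptions on `ψ`: nondecreasing, continuous, odd and unbounded. -/
structure IsNonlinearity (ψ : ℝ → ℝ) : Prop where
  monotone : Monotone ψ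
  continuous : Continuous ψ
  odd : ∀ s, ψ (-s) = -ψ s
  unbounded : ∀ M : ℝ, ∃ s, M < ψ s

/-- The class `Γ_{p,q}`. -/
structure IsGamma (p q : ℝ) (Ψ : ℝ → ℝ) : Prop where
  nonneg : ∀ s, 0 ≤ Ψ s
  convex : ConvexOn ℝ univ Ψ
  symm : ∀ s, Ψ (-s) = Ψ s
  zero : Ψ 0 = 0
  one : Ψ 1 = 1
  lower : ∀ s, s ≠ 0 → q ≤ s * deriv Ψ s / Ψ s
  upper : ∀ s, s ≠ 0 → s * deriv Ψ s / Ψ s ≤ p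

/-- `F(u) = ∫ Ψ(u(x)) dx`, with values in `[0, ∞]`. -/
def modularF {N : ℕ} (Ψ : ℝ → ℝ) (u : Space N → ℝ) : ℝ≥0∞ :=
  ∫⁻ x, ENNReal.ofReal (Ψ (u x))

/-- `E(u) = (1/2) ∬ Ψ(u(x) - u(y)) J(x - y) dx dy`, with values in `[0, ∞]`. -/
def energyE {N : ℕ} (J : Space N → ℝ) (Ψ : ℝ → ℝ) (u : Space N → ℝ) : ℝ≥0∞ :=
  (1 / 2) * ∫⁻ z : Space N × Space N, ENNReal.ofReal (Ψ (u z.1 - u z.2) * J (z.1 - z.2))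

/-- The integrand of the nonlocal interaction energy. -/
def interactionIntegrand {N : ℕ} (J : Space N → ℝ) (ψ : ℝ → ℝ) (u φ : Space N → ℝ) :
    Space N × Space N → ℝ :=
  fun z => ψ (u z.1 - u z.2) * (φ z.1 - φ z.2) * J (z.1 - z.2)

/-- `𝓔(u; φ) = (1/2) ∬ ψ(u(x) - u(y)) (φ(x) - φ(y)) J(x - y) dx dy`. -/
def interaction {N : ℕ} (J : Space N → ℝ) (ψ : ℝ → ℝ) (u φ : Space N → ℝ) : ℝ :=
  (1 / 2) * ∫ z, interactionIntegrand J ψ u φ z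

/-- The space `W₀^{J,Ψ}(Ω)`: measurable `u : ℝ^N → ℝ` with `F(u) < ∞`, `E(u) < ∞` and `u = 0`
almost everywhere in the complement of `Ω`. -/
def W₀ {N : ℕ} (J : Space N → ℝ) (Ψ : ℝ → ℝ) (Ω : Set (Space N)) : Set (Space N → ℝ) :=
  {u | AEMeasurable u volume ∧ modularF Ψ u < ∞ ∧ energyE J Ψ u < ∞ ∧ ∀ᵐ x, x ∉ Ω → u x = 0}

/-- `u` is a weak solution of `𝓛 u = f(u)` in `Ω`, `u ≥ 0`, `u ≢ 0` in `Ω`, `u = 0` in `Ωᶜ`: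
`𝓔(u; φ) = ∫_Ω f(u) φ` for all `φ ∈ W₀^{J,Ψ}(Ω)`, both integrals converging absolutely. -/
structure IsSolution {N : ℕ} (J : Space N → ℝ) (Ψ ψ : ℝ → ℝ) (Ω : Set (Space N)) (f : ℝ → ℝ)
    (u : Space N → ℝ) : Prop where
  mem : u ∈ W₀ J Ψ Ω
  nonneg : ∀ᵐ x ∂volume.restrict Ω, 0 ≤ u x
  nontrivial : ¬ ∀ᵐ x ∂volume.restrict Ω, u x = 0
  interaction_integrable : ∀ φ ∈ W₀ J Ψ Ω, Integrable (interactionIntegrand J ψ u φ) volume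
  reaction_integrable : ∀ φ ∈ W₀ J Ψ Ω, IntegrableOn (fun x => f (u x) * φ x) Ω volume
  weak_eq : ∀ φ ∈ W₀ J Ψ Ω, interaction J ψ u φ = ∫ x in Ω, f (u x) * φ x

/-- The primitive `G(t) = ∫₀ᵗ f` for `t ≥ 0`, extended to `t < 0` as an even function (`f` is
only given on `[0, ∞)`). -/
def primitiveG (f : ℝ → ℝ) (t : ℝ) : ℝ := ∫ s in (0 : ℝ)..|t|, f s

/-- The functional `I(v) = E(v) - ∫_Ω G(v)`, for `v` with `E(v) < ∞` and `G(v) ∈ L¹(Ω)`. -/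
def functionalI {N : ℕ} (J : Space N → ℝ) (Ψ : ℝ → ℝ) (Ω : Set (Space N)) (f : ℝ → ℝ)
    (v : Space N → ℝ) : ℝ :=
  (energyE J Ψ v).toReal - ∫ x in Ω, primitiveG f (v x)

end NonlocalOrlicz

end

/-!
The solution is obtained by the direct method: a nonnegative global minimizer of
`I(v) = E(v) - ∫_Ω G(v)` is found and its Euler–Lagrange equation is derived.

*Coercivity.* For `x ∈ Ω` all points at large distance from `x` lie outside the bounded set `Ω`, so
the mass of `J` away from the origin gives a Poincaré inequality `∫ Ψ(u) ≤ C E(u)`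
(`modularF_le_energyE`). As `μ + 1 / q < 1`, the primitive satisfies `|G| ≤ ε Ψ + C_ε` for every
`ε > 0` (`IsGamma.subcritical`), and the reaction is absorbed by the energy.

*Compactness.* This is where `J ∉ L¹(B₁)` enters. The truncations `k` of `J` away from the origin
have arbitrarily large mass, and the average of `|u(x) - u(y)|` with respect to `k(x - y)` is small
when `E(u)` is bounded and the mass of `k` is large. Hence functions of bounded energy are uniformly
close in `L¹(Ω)` to their mollifications by one continuous kernel (`exists_mollifier`). These
mollifications form a totally bounded set (`exists_finite_discretization`), so minimizing sequences
have subsequences converging almost everywhere (`exists_subseq_tendsto_ae`). Fatou's lemma, applied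
to `Ψ(u(x) - u(y)) J(x - y)` and to `ε Ψ(u) + C_ε - G(u)`, then gives a minimizer. It may be
replaced by its absolute value, because `G` is even (`exists_minimizer`).

*Negative energy.* For a small cone `χ`, finiteness of `E(χ)` follows from `q > q_*`. Moreover
`E(t χ) = O(t ^ q)`, while `∫_Ω G(t χ) ≥ b t ^ (p μ + 1)` with `b > 0` and `p μ + 1 < q`
(`exists_functionalI_neg`). So the minimum is negative and the minimizer is nontrivial.

*The equation.* The functional has one-sided derivatives at a minimizer `u ≥ 0` in every direction
`φ`, with integrand `f(u) φ` where `u > 0` and `f(0) |φ|` where `u = 0`, since `G` has a corner at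
`0`. The behaviour of `f` near zero forces `f(0) ≥ 0`. Adding the inequalities for `φ` and `-φ`
shows that `f(0) |φ| = 0` almost everywhere on `{u = 0}`, and then they combine to the weak equation
(`weak_eq_of_minimizer`).
-/

namespace NonlocalOrlicz

/-! ### The growth function -/

section Growth

variable {p q : ℝ} {ψ Ψ : ℝ → ℝ}

theorem IsNonlinearity.map_zero (hψ : IsNonlinearity ψ) : ψ 0 = 0 := by
  have := hψ.odd 0
  rw [neg_zero] at this
  linarith

theorem IsNonlinearity.nonneg (hψ : IsNonlinearity ψ) {s : ℝ} (hs : 0 ≤ s) : 0 ≤ ψ s := by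
  simpa [hψ.map_zero] using hψ.monotone hs

theorem IsNonlinearity.abs_map (hψ : IsNonlinearity ψ) (s : ℝ) : |ψ s| = ψ |s| := by
  rcases le_total 0 s with h | h
  · rw [abs_of_nonneg h, abs_of_nonneg (hψ.nonneg h)]
  · have := hψ.nonneg (neg_nonneg.2 h)
    rw [abs_of_nonpos h, hψ.odd, abs_of_nonpos]
    rw [hψ.odd] at this
    linarith

theorem IsGamma.pos (hΨ : IsGamma p q Ψ) (hq : 1 < q) {s : ℝ} (hs : s ≠ 0) : 0 < Ψ s := by
  refine (hΨ.nonneg s).lt_of_ne fun h => ?_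
  have := hΨ.lower s hs
  rw [← h, div_zero] at this
  linarith

theorem IsGamma.map_abs (hΨ : IsGamma p q Ψ) (s : ℝ) : Ψ |s| = Ψ s := by
  rcases abs_choice s with h | h <;> rw [h]
  exact hΨ.symm s

theorem continuous_growth (hd : ∀ s, HasDerivAt Ψ (ψ s) s) : Continuous Ψ :=
  continuous_iff_continuousAt.2 fun s => (hd s).continuousAt

theorem IsGamma.mono_abs (hΨ : IsGamma p q Ψ) {a b : ℝ} (hab : |a| ≤ |b|) : Ψ a ≤ Ψ b := by
  rw [← hΨ.map_abs a, ← hΨ.map_abs b]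
  -- `|a|` lies on the segment joining `-|b|` and `|b|`, where `Ψ` has equal values.
  have h : |a| ∈ segment ℝ (-|b|) |b| := by
    rw [segment_eq_Icc (by linarith [abs_nonneg b])]
    exact ⟨by linarith [abs_nonneg a, abs_nonneg b], hab⟩
  simpa [hΨ.symm] using hΨ.convex.le_on_segment (mem_univ _) (mem_univ _) h

theorem IsGamma.mul_deriv_le (hΨ : IsGamma p q Ψ) (hd : ∀ s, HasDerivAt Ψ (ψ s) s) (hq : 1 < q)
    (s : ℝ) : s * ψ s ≤ p * Ψ s := by
  rcases eq_or_ne s 0 with rfl | hs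
  · simp [hΨ.zero]
  · have := hΨ.upper s hs
    rwa [(hd s).deriv, div_le_iff₀ (hΨ.pos hq hs)] at this

theorem IsGamma.le_mul_deriv (hΨ : IsGamma p q Ψ) (hd : ∀ s, HasDerivAt Ψ (ψ s) s) (hq : 1 < q)
    (s : ℝ) : q * Ψ s ≤ s * ψ s := by
  rcases eq_or_ne s 0 with rfl | hs
  · simp [hΨ.zero]
  · have := hΨ.lower s hs
    rwa [(hd s).deriv, le_div_iff₀ (hΨ.pos hq hs)] at this

theorem hasDerivAt_mul_rpow (hd : ∀ s, HasDerivAt Ψ (ψ s) s) (r : ℝ) {x : ℝ} (hx : 0 < x) :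
    HasDerivAt (fun x => Ψ x * x ^ (-r)) (x ^ (-r - 1) * (x * ψ x - r * Ψ x)) x := by
  refine ((hd x).mul (Real.hasDerivAt_rpow_const (p := -r) (Or.inl hx.ne'))).congr_deriv ?_
  rw [show x ^ (-r) = x ^ (-r - 1) * x by
    rw [← Real.rpow_add_one hx.ne']; congr 1; ring]
  ring

/-- `Ψ(x) / x ^ q` is nondecreasing on `(0, ∞)`. -/
theorem IsGamma.scale_le (hΨ : IsGamma p q Ψ) (hd : ∀ s, HasDerivAt Ψ (ψ s) s) (hq : 1 < q)
    {t : ℝ} (ht0 : 0 < t) (ht1 : t ≤ 1) (s : ℝ) : Ψ (t * s) ≤ t ^ q * Ψ s := by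
  have hm : MonotoneOn (fun x => Ψ x * x ^ (-q)) (Ioi 0) := by
    apply monotoneOn_of_deriv_nonneg (convex_Ioi 0)
    · exact fun x hx => (hasDerivAt_mul_rpow hd q hx).continuousAt.continuousWithinAt
    · rw [interior_Ioi]
      exact fun x hx => (hasDerivAt_mul_rpow hd q hx).differentiableAt.differentiableWithinAt
    · rw [interior_Ioi]
      intro x hx
      rw [(hasDerivAt_mul_rpow hd q hx).deriv]
      exact mul_nonneg (Real.rpow_nonneg (le_of_lt hx) _)
        (sub_nonneg.2 (hΨ.le_mul_deriv hd hq x))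
  rcases eq_or_ne s 0 with rfl | hs
  · simp [hΨ.zero]
  have hs' : 0 < |s| := abs_pos.2 hs
  have h := hm (show t * |s| ∈ Ioi 0 from mul_pos ht0 hs') hs' (by nlinarith)
  simp only [Real.mul_rpow ht0.le hs'.le] at h
  have h1 : Ψ (t * |s|) = Ψ (t * s) := by
    rw [← hΨ.map_abs (t * s), abs_mul, abs_of_pos ht0]
  rw [h1, hΨ.map_abs, ← mul_assoc,
    mul_le_mul_iff_left₀ (Real.rpow_pos_of_pos hs' _), Real.rpow_neg ht0.le,
    ← div_eq_mul_inv, div_le_iff₀ (Real.rpow_pos_of_pos ht0 _)] at h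
  linarith

/-- `Ψ(x) / x ^ p` is nonincreasing on `(0, ∞)`. -/
theorem IsGamma.le_scale (hΨ : IsGamma p q Ψ) (hd : ∀ s, HasDerivAt Ψ (ψ s) s) (hq : 1 < q)
    {t : ℝ} (ht0 : 0 < t) (ht1 : t ≤ 1) (s : ℝ) : t ^ p * Ψ s ≤ Ψ (t * s) := by
  have hm : AntitoneOn (fun x => Ψ x * x ^ (-p)) (Ioi 0) := by
    apply antitoneOn_of_deriv_nonpos (convex_Ioi 0)
    · exact fun x hx => (hasDerivAt_mul_rpow hd p hx).continuousAt.continuousWithinAt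
    · rw [interior_Ioi]
      exact fun x hx => (hasDerivAt_mul_rpow hd p hx).differentiableAt.differentiableWithinAt
    · rw [interior_Ioi]
      intro x hx
      rw [(hasDerivAt_mul_rpow hd p hx).deriv]
      exact mul_nonpos_of_nonneg_of_nonpos (Real.rpow_nonneg (le_of_lt hx) _)
        (sub_nonpos.2 (hΨ.mul_deriv_le hd hq x))
  rcases eq_or_ne s 0 with rfl | hs
  · simp [hΨ.zero]
  have hs' : 0 < |s| := abs_pos.2 hs
  have h := hm (show t * |s| ∈ Ioi 0 from mul_pos ht0 hs') hs' (by nlinarith)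
  simp only [Real.mul_rpow ht0.le hs'.le] at h
  have h1 : Ψ (t * |s|) = Ψ (t * s) := by
    rw [← hΨ.map_abs (t * s), abs_mul, abs_of_pos ht0]
  rw [h1, hΨ.map_abs, ← mul_assoc,
    mul_le_mul_iff_left₀ (Real.rpow_pos_of_pos hs' _), Real.rpow_neg ht0.le,
    ← div_eq_mul_inv, le_div_iff₀ (Real.rpow_pos_of_pos ht0 _)] at h
  linarith

theorem IsGamma.rpow_le (hΨ : IsGamma p q Ψ) (hd : ∀ s, HasDerivAt Ψ (ψ s) s) (hq : 1 < q)
    {s : ℝ} (hs : 1 ≤ |s|) : |s| ^ q ≤ Ψ s := by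
  have h0 : 0 < |s| := by linarith
  have h := hΨ.scale_le hd hq (inv_pos.2 h0) (inv_le_one_of_one_le₀ hs) |s|
  rw [inv_mul_cancel₀ h0.ne', hΨ.one, hΨ.map_abs, Real.inv_rpow h0.le,
    inv_mul_eq_div, le_div_iff₀ (Real.rpow_pos_of_pos h0 _), one_mul] at h
  exact h

theorem IsGamma.add_le (hΨ : IsGamma p q Ψ) (hd : ∀ s, HasDerivAt Ψ (ψ s) s) (hq : 1 < q)
    (a b : ℝ) : Ψ (a + b) ≤ 2 ^ p * (Ψ a + Ψ b) := by
  have key : ∀ c : ℝ, Ψ (2 * c) ≤ 2 ^ p * Ψ c := by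
    intro c
    have h := hΨ.le_scale hd hq (t := 1 / 2) (by norm_num) (by norm_num) (2 * c)
    rw [show (1 / 2 : ℝ) * (2 * c) = c by ring, Real.div_rpow one_pos.le zero_le_two,
      Real.one_rpow, div_mul_eq_mul_div, one_mul, div_le_iff₀ (by positivity)] at h
    linarith
  have hp : (0 : ℝ) < 2 ^ p := by positivity
  rcases le_total |a| |b| with h | h
  · calc Ψ (a + b) ≤ Ψ (2 * b) := hΨ.mono_abs (by
          rw [abs_mul, abs_two]; linarith [abs_add_le a b])
      _ ≤ _ := (key b).trans (mul_le_mul_of_nonneg_left (by linarith [hΨ.nonneg a]) hp.le)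
  · calc Ψ (a + b) ≤ Ψ (2 * a) := hΨ.mono_abs (by
          rw [abs_mul, abs_two]; linarith [abs_add_le a b])
      _ ≤ _ := (key a).trans (mul_le_mul_of_nonneg_left (by linarith [hΨ.nonneg b]) hp.le)

/-- A Young-type inequality; it makes the interaction energy converge absolutely. -/
theorem IsGamma.abs_deriv_mul_le (hΨ : IsGamma p q Ψ) (hψ : IsNonlinearity ψ)
    (hd : ∀ s, HasDerivAt Ψ (ψ s) s) (hq : 1 < q) (hqp : q ≤ p) (a b : ℝ) :
    |ψ a * b| ≤ p * (Ψ a + Ψ b) := by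
  have hm : ∀ m : ℝ, |m| * ψ |m| ≤ p * Ψ m := fun m => by
    simpa [hΨ.map_abs] using hΨ.mul_deriv_le hd hq |m|
  have hp : 0 < p := by linarith
  rw [abs_mul, hψ.abs_map]
  have ha := hψ.nonneg (abs_nonneg a)
  have hb := hψ.nonneg (abs_nonneg b)
  rcases le_total |a| |b| with h | h
  · calc ψ |a| * |b| ≤ ψ |b| * |b| :=
          mul_le_mul_of_nonneg_right (hψ.monotone h) (abs_nonneg _)
      _ ≤ p * Ψ b := by linarith [hm b]
      _ ≤ _ := mul_le_mul_of_nonneg_left (by linarith [hΨ.nonneg a]) hp.le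
  · calc ψ |a| * |b| ≤ ψ |a| * |a| := mul_le_mul_of_nonneg_left h ha
      _ ≤ p * Ψ a := by linarith [hm a]
      _ ≤ _ := mul_le_mul_of_nonneg_left (by linarith [hΨ.nonneg b]) hp.le

/-- `Ψ` lies above the chord through the origin beyond `η`, so it dominates `|s|` up to `η`. -/
theorem IsGamma.abs_le_add_mul (hΨ : IsGamma p q Ψ) (hd : ∀ s, HasDerivAt Ψ (ψ s) s) (hq : 1 < q)
    {η : ℝ} (hη : 0 < η) (s : ℝ) : |s| ≤ η + η / Ψ η * Ψ s := by
  have hη' := hΨ.pos hq hη.ne'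
  rcases le_total |s| η with h | h
  · have : 0 ≤ η / Ψ η * Ψ s := mul_nonneg (by positivity) (hΨ.nonneg s)
    linarith
  · have hs : 0 < |s| := hη.trans_le h
    have h1 := hΨ.scale_le hd hq (div_pos hη hs) ((div_le_one hs).2 h) |s|
    rw [div_mul_cancel₀ _ hs.ne', hΨ.map_abs] at h1
    have h2 : (η / |s|) ^ q ≤ η / |s| := by
      simpa using Real.rpow_le_rpow_of_exponent_ge (div_pos hη hs) ((div_le_one hs).2 h) hq.le
    have h3 : Ψ η ≤ η / |s| * Ψ s := h1.trans (mul_le_mul_of_nonneg_right h2 (hΨ.nonneg s))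
    rw [div_mul_eq_mul_div, le_div_iff₀ hs] at h3
    have : |s| ≤ η / Ψ η * Ψ s := by
      rw [div_mul_eq_mul_div, le_div_iff₀ hη']; linarith
    linarith

/-- The growth of the reaction is strictly below that of `Ψ`, since `μ + 1 / q < 1`. -/
theorem IsGamma.subcritical (hΨ : IsGamma p q Ψ) (hd : ∀ s, HasDerivAt Ψ (ψ s) s) (hq : 1 < q)
    (hqp : q ≤ p) {μ : ℝ} (hμ0 : 0 < μ) (hμ : μ < (q - 1) / p) {c : ℝ} (hc : 0 ≤ c)
    {ε : ℝ} (hε : 0 < ε) :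
    ∃ C, 0 ≤ C ∧ ∀ t, |t| * (c * (1 + Ψ t ^ μ)) ≤ ε * Ψ t + C := by
  have hq0 : 0 < q := by linarith
  have hθ : μ + 1 / q < 1 := by
    have : (q - 1) / p ≤ (q - 1) / q := div_le_div_of_nonneg_left (by linarith) hq0 hqp
    have h2 : (q - 1) / q + 1 / q = 1 := by field_simp; ring
    linarith
  have hθ0 : 0 < μ + 1 / q := by positivity
  obtain ⟨K, hK⟩ := eventually_atTop.1
    ((tendsto_rpow_neg_atTop (sub_pos.2 hθ)).eventually_le_const
      (show 0 < ε / (2 * c + 1) by positivity))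
  set L := max K 1 with hL
  have hL0 : 0 < L := lt_of_lt_of_le one_pos (le_max_right _ _)
  refine ⟨2 * c * L ^ (μ + 1 / q) + 2 * c, by positivity, fun t => ?_⟩
  have hA := hΨ.nonneg t
  rcases le_total |t| 1 with ht | ht
  · have h1 : Ψ t ≤ 1 := by
      rw [← hΨ.one]; exact hΨ.mono_abs (by simpa using ht)
    have h2 : Ψ t ^ μ ≤ 1 := Real.rpow_le_one hA h1 hμ0.le
    have h3 : |t| * (c * (1 + Ψ t ^ μ)) ≤ 1 * (c * (1 + 1)) := by
      gcongr
    have : 0 ≤ 2 * c * L ^ (μ + 1 / q) := by positivity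
    nlinarith
  · have h1 := hΨ.rpow_le hd hq ht
    have hA1 : 1 ≤ Ψ t := (Real.one_le_rpow ht hq0.le).trans h1
    have h2 : |t| ≤ Ψ t ^ (1 / q) := by
      rwa [one_div, Real.le_rpow_inv_iff_of_pos (abs_nonneg t) hA hq0]
    have h3 : 1 ≤ Ψ t ^ μ := Real.one_le_rpow hA1 hμ0.le
    have h4 : |t| * (c * (1 + Ψ t ^ μ)) ≤ 2 * c * Ψ t ^ (μ + 1 / q) := by
      rw [Real.rpow_add (by linarith)]
      calc |t| * (c * (1 + Ψ t ^ μ)) ≤ Ψ t ^ (1 / q) * (c * (Ψ t ^ μ + Ψ t ^ μ)) := by gcongr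
        _ = _ := by ring
    refine h4.trans ?_
    rcases le_total (Ψ t) L with h | h
    · have : Ψ t ^ (μ + 1 / q) ≤ L ^ (μ + 1 / q) := Real.rpow_le_rpow hA h hθ0.le
      have := mul_le_mul_of_nonneg_left this (show 0 ≤ 2 * c by positivity)
      nlinarith [mul_nonneg hε.le hA]
    · have h5 := hK (Ψ t) ((le_max_left _ _).trans h)
      have hA0 : 0 < Ψ t := by linarith
      replace h5 := mul_le_mul_of_nonneg_right h5 hA
      rw [← Real.rpow_add_one hA0.ne',
        show -(1 - (μ + 1 / q)) + 1 = μ + 1 / q by ring] at h5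
      have h6 := mul_le_mul_of_nonneg_left h5 (show 0 ≤ 2 * c by positivity)
      have h7 : 2 * c * (ε / (2 * c + 1) * Ψ t) ≤ ε * Ψ t := by
        rw [← mul_assoc]
        refine mul_le_mul_of_nonneg_right ?_ hA
        rw [mul_div_assoc', div_le_iff₀ (by positivity)]
        nlinarith
      have : 0 ≤ 2 * c * L ^ (μ + 1 / q) + 2 * c := by positivity
      linarith

end Growth

/-! ### The kernel and the space `W₀` -/

section Space

variable {N : ℕ} {p q : ℝ} {J : Space N → ℝ} {ψ Ψ : ℝ → ℝ} {Ω : Set (Space N)}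

/-- In dimension zero every function is integrable, so the kernel forces `N ≠ 0`. -/
theorem IsKernel.nontrivial (hJ : IsKernel J) : Nontrivial (Space N) := by
  rcases Nat.eq_zero_or_pos N with rfl | hN
  · refine absurd ?_ hJ.not_integrable
    have : J = fun _ => J 0 := funext fun z => congrArg J (Subsingleton.elim _ _)
    rw [this]
    exact integrableOn_const measure_ball_lt_top.ne
  · have : Nonempty (Fin N) := ⟨⟨0, hN⟩⟩
    infer_instance

theorem IsKernel.ae_pos (hJ : IsKernel J) : ∀ᵐ z : Space N, 0 < J z := by
  have := hJ.nontrivial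
  filter_upwards [compl_mem_ae_iff.2 (measure_singleton (0 : Space N))] with z hz
  exact hJ.pos z hz

theorem quasiMeasurePreserving_pair_sub :
    Measure.QuasiMeasurePreserving (fun z : Space N × Space N => z.1 - z.2) volume volume :=
  quasiMeasurePreserving_sub_of_right_invariant volume volume

theorem IsKernel.ae_pair_pos (hJ : IsKernel J) : ∀ᵐ z : Space N × Space N, 0 < J (z.1 - z.2) :=
  quasiMeasurePreserving_pair_sub.ae hJ.ae_pos

theorem IsKernel.aemeasurable_pair (hJ : IsKernel J) :
    AEMeasurable (fun z : Space N × Space N => J (z.1 - z.2)) :=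
  hJ.aemeasurable.comp_quasiMeasurePreserving quasiMeasurePreserving_pair_sub

theorem aemeasurable_pair_diff {u : Space N → ℝ} (hu : AEMeasurable u) :
    AEMeasurable (fun z : Space N × Space N => u z.1 - u z.2) :=
  (hu.comp_quasiMeasurePreserving Measure.quasiMeasurePreserving_fst).sub
    (hu.comp_quasiMeasurePreserving Measure.quasiMeasurePreserving_snd)

theorem aemeasurable_energy (hJ : IsKernel J) (hc : Continuous Ψ) {u : Space N → ℝ}
    (hu : AEMeasurable u) :
    AEMeasurable (fun z : Space N × Space N => Ψ (u z.1 - u z.2) * J (z.1 - z.2)) :=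
  (hc.measurable.comp_aemeasurable (aemeasurable_pair_diff hu)).mul hJ.aemeasurable_pair

theorem ae_energy_nonneg (hJ : IsKernel J) (hΨ : IsGamma p q Ψ) (u : Space N → ℝ) :
    0 ≤ᵐ[volume] fun z : Space N × Space N => Ψ (u z.1 - u z.2) * J (z.1 - z.2) := by
  filter_upwards [hJ.ae_pair_pos] with z hz
  exact mul_nonneg (hΨ.nonneg _) hz.le

theorem energyE_lt_top_iff (hJ : IsKernel J) (hΨ : IsGamma p q Ψ) (hc : Continuous Ψ)
    {u : Space N → ℝ} (hu : AEMeasurable u) : energyE J Ψ u < ∞ ↔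
      Integrable (fun z : Space N × Space N => Ψ (u z.1 - u z.2) * J (z.1 - z.2)) := by
  rw [← lintegral_ofReal_ne_top_iff_integrable (aemeasurable_energy hJ hc hu).aestronglyMeasurable
    (ae_energy_nonneg hJ hΨ u), energyE, ← lt_top_iff_ne_top]
  constructor
  · intro h
    by_contra h'
    rw [not_lt, top_le_iff] at h'
    rw [h', ENNReal.mul_top (by simp)] at h
    exact h.ne rfl
  · exact fun h => ENNReal.mul_lt_top (by simp) h

theorem toReal_energyE (hJ : IsKernel J) (hΨ : IsGamma p q Ψ) (hc : Continuous Ψ)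
    {u : Space N → ℝ} (hu : AEMeasurable u) : (energyE J Ψ u).toReal =
      (1 / 2) * ∫ z : Space N × Space N, Ψ (u z.1 - u z.2) * J (z.1 - z.2) := by
  rw [integral_eq_lintegral_of_nonneg_ae (ae_energy_nonneg hJ hΨ u)
    (aemeasurable_energy hJ hc hu).aestronglyMeasurable, energyE, ENNReal.toReal_mul]
  simp

theorem aemeasurable_growth (hc : Continuous Ψ) {u : Space N → ℝ} (hu : AEMeasurable u) :
    AEMeasurable (fun x => Ψ (u x)) :=
  hc.measurable.comp_aemeasurable hu

theorem modularF_lt_top_iff (hΨ : IsGamma p q Ψ) (hc : Continuous Ψ)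
    {u : Space N → ℝ} (hu : AEMeasurable u) :
    modularF Ψ u < ∞ ↔ Integrable (fun x => Ψ (u x)) := by
  rw [← lintegral_ofReal_ne_top_iff_integrable
    (aemeasurable_growth hc hu).aestronglyMeasurable
    (Eventually.of_forall fun x => hΨ.nonneg _), modularF, ← lt_top_iff_ne_top]

theorem mem_W₀_iff (hJ : IsKernel J) (hΨ : IsGamma p q Ψ) (hc : Continuous Ψ)
    {u : Space N → ℝ} : u ∈ W₀ J Ψ Ω ↔ AEMeasurable u ∧ Integrable (fun x => Ψ (u x)) ∧
      Integrable (fun z : Space N × Space N => Ψ (u z.1 - u z.2) * J (z.1 - z.2)) ∧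
      ∀ᵐ x, x ∉ Ω → u x = 0 := by
  constructor
  · rintro ⟨h1, h2, h3, h4⟩
    exact ⟨h1, (modularF_lt_top_iff hΨ hc h1).1 h2, (energyE_lt_top_iff hJ hΨ hc h1).1 h3, h4⟩
  · rintro ⟨h1, h2, h3, h4⟩
    exact ⟨h1, (modularF_lt_top_iff hΨ hc h1).2 h2, (energyE_lt_top_iff hJ hΨ hc h1).2 h3, h4⟩

theorem mem_W₀_of_le (hJ : IsKernel J) (hΨ : IsGamma p q Ψ) (hc : Continuous Ψ)
    {u v w : Space N → ℝ} (hu : u ∈ W₀ J Ψ Ω) (hv : v ∈ W₀ J Ψ Ω) (hw : AEMeasurable w) (C : ℝ)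
    (h1 : ∀ x, Ψ (w x) ≤ C * (Ψ (u x) + Ψ (v x)))
    (h2 : ∀ x y, Ψ (w x - w y) ≤ C * (Ψ (u x - u y) + Ψ (v x - v y)))
    (h3 : ∀ x, u x = 0 → v x = 0 → w x = 0) : w ∈ W₀ J Ψ Ω := by
  rw [mem_W₀_iff hJ hΨ hc] at *
  refine ⟨hw, ?_, ?_, ?_⟩
  · refine ((hu.2.1.add hv.2.1).const_mul C).mono'
      (aemeasurable_growth hc hw).aestronglyMeasurable (Eventually.of_forall fun x => ?_)
    rw [Real.norm_of_nonneg (hΨ.nonneg _)]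
    exact h1 x
  · refine ((hu.2.2.1.add hv.2.2.1).const_mul C).mono'
      (aemeasurable_energy hJ hc hw).aestronglyMeasurable ?_
    filter_upwards [hJ.ae_pair_pos] with z hz
    rw [Real.norm_of_nonneg (mul_nonneg (hΨ.nonneg _) hz.le)]
    simp only [Pi.add_apply, ← add_mul, ← mul_assoc]
    exact mul_le_mul_of_nonneg_right (h2 _ _) hz.le
  · filter_upwards [hu.2.2.2, hv.2.2.2] with x hx hx' hxΩ
    exact h3 x (hx hxΩ) (hx' hxΩ)

theorem abs_mem_W₀ (hJ : IsKernel J) (hΨ : IsGamma p q Ψ) (hc : Continuous Ψ)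
    {u : Space N → ℝ} (hu : u ∈ W₀ J Ψ Ω) : (fun x => |u x|) ∈ W₀ J Ψ Ω :=
  mem_W₀_of_le hJ hΨ hc hu hu hu.1.abs 1
    (fun x => by rw [hΨ.map_abs]; linarith [hΨ.nonneg (u x)])
    (fun x y => by
      linarith [hΨ.mono_abs (abs_abs_sub_abs_le_abs_sub (u x) (u y)), hΨ.nonneg (u x - u y)])
    (by simp)

theorem add_mul_mem_W₀ (hJ : IsKernel J) (hΨ : IsGamma p q Ψ)
    (hd : ∀ s, HasDerivAt Ψ (ψ s) s) (hq : 1 < q)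
    {u φ : Space N → ℝ} (hu : u ∈ W₀ J Ψ Ω) (hφ : φ ∈ W₀ J Ψ Ω) {t : ℝ} (ht : |t| ≤ 1) :
    (fun x => u x + t * φ x) ∈ W₀ J Ψ Ω := by
  have hp : (0 : ℝ) < 2 ^ p := by positivity
  have key : ∀ a b : ℝ, Ψ (a + t * b) ≤ 2 ^ p * (Ψ a + Ψ b) := fun a b => by
    refine (hΨ.add_le hd hq _ _).trans (mul_le_mul_of_nonneg_left ?_ hp.le)
    have : Ψ (t * b) ≤ Ψ b := hΨ.mono_abs (by
      rw [abs_mul]; exact mul_le_of_le_one_left (abs_nonneg _) ht)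
    linarith
  refine mem_W₀_of_le hJ hΨ (continuous_growth hd) hu hφ (hu.1.add (hφ.1.const_mul t)) (2 ^ p)
    (fun x => key _ _) (fun x y => ?_) (fun x h h' => by simp [h, h'])
  rw [show u x + t * φ x - (u y + t * φ y) = (u x - u y) + t * (φ x - φ y) by ring]
  exact key _ _

theorem energyE_abs_le (hJ : IsKernel J) (hΨ : IsGamma p q Ψ) (u : Space N → ℝ) :
    energyE J Ψ (fun x => |u x|) ≤ energyE J Ψ u := by
  refine mul_le_mul_right (lintegral_mono_ae ?_) _
  filter_upwards [hJ.ae_pair_pos] with z hz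
  exact ENNReal.ofReal_le_ofReal (mul_le_mul_of_nonneg_right
    (hΨ.mono_abs (abs_abs_sub_abs_le_abs_sub _ _)) hz.le)

/-- Poincaré's inequality. For `x ∈ Ω` every `y = x - z` with `‖z‖` large lies outside `Ω`, where
`u y = 0`, so the mass of `J` away from the origin controls `Ψ (u x)`. -/
theorem modularF_le_energyE (hJ : IsKernel J) (hΨ : IsGamma p q Ψ) (hc : Continuous Ψ)
    (hΩb : Bornology.IsBounded Ω) :
    ∃ C : ℝ≥0∞, C ≠ ∞ ∧ ∀ u ∈ W₀ J Ψ Ω, modularF Ψ u ≤ C * energyE J Ψ u := by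
  have := hJ.nontrivial
  obtain ⟨R, hR⟩ := hΩb.subset_closedBall 0
  set T : Set (Space N) := {z | 2 * R < ‖z‖} with hT
  have hTo : IsOpen T := isOpen_lt continuous_const continuous_norm
  have hTne : T.Nonempty := NormedSpace.exists_lt_norm ℝ (Space N) (2 * R)
  set κ : ℝ≥0∞ := ∫⁻ z, T.indicator (fun z => ENNReal.ofReal (J z)) z with hκ
  have hκ0 : κ ≠ 0 := by
    intro h
    rw [hκ, lintegral_eq_zero_iff'
      (hJ.aemeasurable.ennreal_ofReal.indicator hTo.measurableSet)] at h
    refine (hTo.measure_pos volume hTne).ne' (compl_mem_ae_iff.1 ?_)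
    filter_upwards [h, hJ.ae_pos] with z hz hz' hzT
    rw [indicator_of_mem hzT, Pi.zero_apply, ENNReal.ofReal_eq_zero] at hz
    linarith
  refine ⟨κ⁻¹ * 2, ENNReal.mul_ne_top (ENNReal.inv_ne_top.2 hκ0) (by simp), fun u hu => ?_⟩
  have h2 : 2 * energyE J Ψ u =
      ∫⁻ x, ∫⁻ y, ENNReal.ofReal (Ψ (u x - u y) * J (x - y)) := by
    rw [energyE, ← mul_assoc, one_div, ENNReal.mul_inv_cancel (by simp) (by simp), one_mul,
      Measure.volume_eq_prod, lintegral_prod _ (aemeasurable_energy hJ hc hu.1).ennreal_ofReal]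
  have h3 : modularF Ψ u * κ ≤ 2 * energyE J Ψ u := by
    rw [h2, modularF, ← lintegral_mul_const'' _
      (aemeasurable_growth hc hu.1).ennreal_ofReal]
    refine lintegral_mono_ae ?_
    filter_upwards [hu.2.2.2] with x hx
    by_cases hxΩ : x ∈ Ω
    swap
    · simp [hx hxΩ, hΨ.zero]
    rw [hκ, ← lintegral_sub_left_eq_self _ x, ← lintegral_const_mul' _ _ ENNReal.ofReal_ne_top]
    refine lintegral_mono_ae ?_
    filter_upwards [hu.2.2.2] with y hy
    by_cases hxy : x - y ∈ T
    · rw [indicator_of_mem hxy, hy, sub_zero, ENNReal.ofReal_mul (hΨ.nonneg _)]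
      intro hyΩ
      have h1 : ‖x‖ ≤ R := by simpa using hR hxΩ
      have h2 : ‖y‖ ≤ R := by simpa using hR hyΩ
      have h3 : 2 * R < ‖x - y‖ := hxy
      linarith [norm_sub_le x y]
    · rw [indicator_of_notMem hxy, mul_zero]
      exact zero_le
  rwa [mul_assoc, mul_comm, ← div_eq_mul_inv, ENNReal.le_div_iff_mul_le (Or.inl hκ0)
    (Or.inr (ENNReal.mul_ne_top (by simp) hu.2.2.1.ne))]

end Space

/-! ### Compactness from the non-integrability of the kernel -/

section Compactness

variable {N : ℕ} {p q : ℝ} {J : Space N → ℝ} {ψ Ψ : ℝ → ℝ} {Ω : Set (Space N)}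

theorem lintegral_enorm_le (hΨ : IsGamma p q Ψ) (hd : ∀ s, HasDerivAt Ψ (ψ s) s) (hq : 1 < q)
    (hΩo : IsOpen Ω) {u : Space N → ℝ} (hu : u ∈ W₀ J Ψ Ω) :
    ∫⁻ x, ‖u x‖ₑ ≤ volume Ω + modularF Ψ u := by
  have h1 : ∫⁻ x, ‖u x‖ₑ ≤ ∫⁻ x, (Ω.indicator 1 x + ENNReal.ofReal (Ψ (u x))) := by
    refine lintegral_mono_ae ?_
    filter_upwards [hu.2.2.2] with x hx
    by_cases hxΩ : x ∈ Ω
    · rw [indicator_of_mem hxΩ, Pi.one_apply, ← ENNReal.ofReal_one,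
        ← ENNReal.ofReal_add zero_le_one (hΨ.nonneg _), ← ofReal_norm, Real.norm_eq_abs]
      refine ENNReal.ofReal_le_ofReal ?_
      simpa [hΨ.one] using hΨ.abs_le_add_mul hd hq one_pos (u x)
    · simp [hx hxΩ]
  refine h1.trans ?_
  rw [lintegral_add_left (measurable_one.indicator hΩo.measurableSet),
    lintegral_indicator_one hΩo.measurableSet, modularF]

theorem integrable_of_mem_W₀ (hΨ : IsGamma p q Ψ) (hd : ∀ s, HasDerivAt Ψ (ψ s) s) (hq : 1 < q)
    (hΩo : IsOpen Ω) (hΩb : Bornology.IsBounded Ω) {u : Space N → ℝ} (hu : u ∈ W₀ J Ψ Ω) :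
    Integrable u :=
  ⟨hu.1.aestronglyMeasurable, (lintegral_enorm_le hΨ hd hq hΩo hu).trans_lt
    (ENNReal.add_lt_top.2 ⟨hΩb.measure_lt_top, hu.2.1⟩)⟩

/-- The truncations of the kernel away from the origin are integrable, with arbitrarily large
integrals. -/
theorem IsKernel.exists_truncation (hJ : IsKernel J) (B : ℝ) :
    ∃ T : Set (Space N), MeasurableSet T ∧ IntegrableOn J T ∧ B < ∫ z in T, J z := by
  have := hJ.nontrivial
  obtain ⟨r, hr, hint⟩ := hJ.exists_moment
  let T : ℕ → Set (Space N) := fun n => {z | 1 / ((n : ℝ) + 1) ≤ ‖z‖}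
  have hTm : ∀ n, MeasurableSet (T n) := fun n =>
    (isClosed_le continuous_const continuous_norm).measurableSet
  have hTi : ∀ n, IntegrableOn J (T n) := by
    intro n
    set δ : ℝ := 1 / ((n : ℝ) + 1) with hδ
    have hδ0 : 0 < δ := by positivity
    have hδ1 : δ ≤ 1 := by
      rw [hδ, div_le_one (by positivity)]; linarith [(Nat.cast_nonneg n : (0 : ℝ) ≤ n)]
    refine (hint.const_mul (δ ^ r)⁻¹).integrableOn.mono'
      hJ.aemeasurable.aestronglyMeasurable.restrict ?_
    refine (ae_restrict_iff' (hTm n)).2 ?_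
    filter_upwards [hJ.ae_pos] with z hz hzT
    rw [Real.norm_of_nonneg hz.le, ← mul_assoc]
    refine le_mul_of_one_le_left hz.le ?_
    rw [inv_mul_eq_div, one_le_div (by positivity)]
    exact le_min (Real.rpow_le_one hδ0.le hδ1 hr.le) (Real.rpow_le_rpow hδ0.le hzT hr.le)
  by_contra! hcon
  have hcover : AECover (volume : Measure (Space N)) atTop T := by
    refine ⟨?_, hTm⟩
    filter_upwards [compl_mem_ae_iff.2 (measure_singleton (0 : Space N))] with z hz
    have hz' : 0 < ‖z‖ := norm_pos_iff.2 hz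
    exact (tendsto_one_div_add_atTop_nhds_zero_nat.eventually_lt_const hz').mono
      fun n hn => le_of_lt hn
  refine hJ.not_integrable (Integrable.integrableOn
    (hcover.integrable_of_integral_norm_bounded B hTi (Eventually.of_forall fun n => ?_)))
  refine le_trans (le_of_eq (integral_congr_ae ?_)) (hcon (T n) (hTm n) (hTi n))
  filter_upwards [ae_restrict_of_ae hJ.ae_pos] with z hz
  exact Real.norm_of_nonneg hz.le

theorem integrable_sub_mul {g u : Space N → ℝ} (hgc : Continuous g) (hgs : HasCompactSupport g)
    (hu : Integrable u) (x : Space N) : Integrable (fun y => g (x - y) * u y) := by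
  obtain ⟨C, hC⟩ := hgc.bounded_above_of_compact_support hgs
  exact hu.bdd_mul (hgc.comp (continuous_const.sub continuous_id)).aestronglyMeasurable
    (Eventually.of_forall fun y => hC _)

theorem aestronglyMeasurable_integral_sub_mul {g u : Space N → ℝ} (hgc : Continuous g)
    (hu : AEMeasurable u) (ν : Measure (Space N)) (hν : ν ≪ volume) :
    AEStronglyMeasurable (fun x => ∫ y, g (x - y) * u y) ν := by
  have h : AEStronglyMeasurable (fun z : Space N × Space N => g (z.1 - z.2) * u z.2)
      (volume.prod volume) :=
    ((hgc.comp (continuous_fst.sub continuous_snd)).aestronglyMeasurable).mul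
      (hu.comp_quasiMeasurePreserving Measure.quasiMeasurePreserving_snd).aestronglyMeasurable
  exact h.integral_prod_right'.mono_ac hν

/-- Functions of bounded energy are uniformly close in `L¹(Ω)` to their mollifications by a fixed
kernel. Indeed, with `k` a truncation of `J` of large mass, the average of `|u x - u y|` against
`k` is at most `η` plus a multiple of the energy divided by that mass. A continuous `g₀` with
`‖g₀ - k‖₁ ≤ 1`, divided by its mass, serves as the kernel. -/
theorem exists_mollifier (hJ : IsKernel J) (hΨ : IsGamma p q Ψ)
    (hd : ∀ s, HasDerivAt Ψ (ψ s) s) (hq : 1 < q) (hΩo : IsOpen Ω)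
    (hΩb : Bornology.IsBounded Ω) {M L ε : ℝ} (hM : 0 ≤ M) (hL : 0 ≤ L) (hε : 0 < ε) :
    ∃ g : Space N → ℝ, Continuous g ∧ HasCompactSupport g ∧
      ∀ u ∈ W₀ J Ψ Ω, energyE J Ψ u ≤ ENNReal.ofReal M → ∫⁻ x, ‖u x‖ₑ ≤ ENNReal.ofReal L →
        ∫⁻ x in Ω, ‖u x - ∫ y, g (x - y) * u y‖ₑ ≤ ENNReal.ofReal ε := by
  have hc := continuous_growth hd
  have hV : volume Ω ≠ ∞ := hΩb.measure_lt_top.ne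
  set V : ℝ := (volume Ω).toReal with hVdef
  have hV0 : 0 ≤ V := ENNReal.toReal_nonneg
  set η : ℝ := ε / (4 * (V + 1)) with hη
  have hη0 : 0 < η := by positivity
  have hηV : η * V ≤ ε / 4 := by
    rw [hη, div_mul_eq_mul_div, div_le_div_iff₀ (by positivity) (by norm_num)]
    nlinarith
  set C : ℝ := η / Ψ η with hC
  have hC0 : 0 ≤ C := div_nonneg hη0.le (hΨ.nonneg _)
  obtain ⟨T, hTm, hTi, hA⟩ := hJ.exists_truncation (2 * (1 + (2 * C * M + 2 * L) / ε))
  set k : Space N → ℝ := T.indicator J with hk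
  have hki : Integrable k := (integrable_indicator_iff hTm).2 hTi
  set A : ℝ := ∫ z in T, J z with hAdef
  have hkA : ∫ z, k z = A := integral_indicator hTm
  have hk0 : 0 ≤ᵐ[volume] k := by
    filter_upwards [hJ.ae_pos] with z hz
    exact indicator_apply_nonneg (fun _ => hz.le)
  obtain ⟨g, hgs, hgk, hgc, hgi⟩ := hki.exists_hasCompactSupport_integral_sub_le one_pos
  set a : ℝ := ∫ z, g z with ha
  have haA : A - 1 ≤ a := by
    have : ∫ z, (k z - g z) ≤ 1 :=
      (integral_mono (hki.sub hgi) (hki.sub hgi).norm fun z => le_abs_self _).trans hgk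
    rw [integral_sub hki hgi, hkA] at this
    linarith
  have hfrac : 0 ≤ (2 * C * M + 2 * L) / ε := by positivity
  have ha0 : 0 < a := by linarith
  have hfinal : η * A * V + 2 * C * M + 2 * L ≤ ε * a := by
    have h1 : (2 * C * M + 2 * L) ≤ ε * (A / 2 - 1) := by
      rw [← div_le_iff₀' hε]; linarith
    have hA0 : 0 ≤ A := by linarith
    nlinarith [mul_le_mul_of_nonneg_right hηV hA0, mul_le_mul_of_nonneg_left haA hε.le]
  refine ⟨fun z => g z / a, hgc.div_const _, ?_, fun u hu huM huL => ?_⟩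
  · exact hgs.comp_left (g := fun s => s / a) (zero_div a)
  have hui := integrable_of_mem_W₀ hΨ hd hq hΩo hΩb hu
  -- The four contributions to the averaged difference.
  let f₁ : Space N × Space N → ℝ≥0∞ := fun z => ENNReal.ofReal (η * k (z.1 - z.2))
  let f₂ : Space N × Space N → ℝ≥0∞ := fun z =>
    ENNReal.ofReal C * ENNReal.ofReal (Ψ (u z.1 - u z.2) * J (z.1 - z.2))
  let f₃ : Space N × Space N → ℝ≥0∞ := fun z => ‖k (z.1 - z.2) - g (z.1 - z.2)‖ₑ * ‖u z.1‖ₑ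
  let f₄ : Space N × Space N → ℝ≥0∞ := fun z => ‖k (z.1 - z.2) - g (z.1 - z.2)‖ₑ * ‖u z.2‖ₑ
  have hdm : AEMeasurable (fun z : Space N × Space N => ‖k (z.1 - z.2) - g (z.1 - z.2)‖ₑ) :=
    ((hki.sub hgi).aestronglyMeasurable.aemeasurable.comp_quasiMeasurePreserving
      quasiMeasurePreserving_pair_sub).enorm
  have hm₁ : AEMeasurable f₁ := ((hki.aestronglyMeasurable.aemeasurable.comp_quasiMeasurePreserving
      quasiMeasurePreserving_pair_sub).const_mul η).ennreal_ofReal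
  have hm₂ : AEMeasurable f₂ := (aemeasurable_energy hJ hc hu.1).ennreal_ofReal.const_mul _
  have hm₃ : AEMeasurable f₃ :=
    hdm.mul (hu.1.comp_quasiMeasurePreserving Measure.quasiMeasurePreserving_fst).enorm
  have hm₄ : AEMeasurable f₄ :=
    hdm.mul (hu.1.comp_quasiMeasurePreserving Measure.quasiMeasurePreserving_snd).enorm
  have hD : ∫⁻ z, ‖k z - g z‖ₑ ≤ 1 := by
    have := ofReal_integral_norm_eq_lintegral_enorm (hki.sub hgi)
    simp only [Pi.sub_apply] at this
    rw [← this]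
    exact ENNReal.ofReal_le_one.2 hgk
  have hle : (volume.restrict Ω).prod (volume : Measure (Space N)) ≤ volume := by
    rw [Measure.volume_eq_prod]
    exact Measure.prod_mono Measure.restrict_le_self le_rfl
  have hI₁ : ∫⁻ z, f₁ z ∂(volume.restrict Ω).prod volume = ENNReal.ofReal (η * A * V) := by
    rw [lintegral_prod _ (hm₁.mono_measure hle)]
    have : ∀ x : Space N, ∫⁻ y, f₁ (x, y) = ENNReal.ofReal (η * A) := fun x => by
      change ∫⁻ y, ENNReal.ofReal (η * k (x - y)) = _
      rw [lintegral_sub_left_eq_self (fun z => ENNReal.ofReal (η * k z)),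
        ← ofReal_integral_eq_lintegral_ofReal (hki.const_mul η)
        (by filter_upwards [hk0] with z hz using mul_nonneg hη0.le hz), integral_const_mul, hkA]
    simp_rw [this]
    rw [lintegral_const, Measure.restrict_apply_univ, ENNReal.ofReal_mul' hV0, hVdef,
      ENNReal.ofReal_toReal hV]
  have hI₂ : ∫⁻ z, f₂ z ∂(volume.restrict Ω).prod volume ≤ ENNReal.ofReal (2 * C * M) := by
    refine (lintegral_mono' hle le_rfl).trans ?_
    rw [lintegral_const_mul' _ _ ENNReal.ofReal_ne_top]
    have h2 : ∫⁻ z : Space N × Space N, ENNReal.ofReal (Ψ (u z.1 - u z.2) * J (z.1 - z.2))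
        = 2 * energyE J Ψ u := by
      rw [energyE, ← mul_assoc, one_div, ENNReal.mul_inv_cancel (by simp) (by simp), one_mul]
    rw [h2, show 2 * C * M = C * (2 * M) by ring, ENNReal.ofReal_mul hC0,
      ENNReal.ofReal_mul zero_le_two, ENNReal.ofReal_ofNat]
    gcongr
  have hI₃ : ∫⁻ z, f₃ z ∂(volume.restrict Ω).prod volume ≤ ENNReal.ofReal L := by
    refine (lintegral_mono' hle le_rfl).trans ?_
    rw [Measure.volume_eq_prod, lintegral_prod _ hm₃]
    refine le_trans (lintegral_mono fun x => ?_) huL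
    change ∫⁻ y, ‖k (x - y) - g (x - y)‖ₑ * ‖u x‖ₑ ≤ _
    rw [lintegral_mul_const' _ _ enorm_ne_top,
      lintegral_sub_left_eq_self (fun z => ‖k z - g z‖ₑ) x]
    exact mul_le_of_le_one_left (by positivity) hD
  have hI₄ : ∫⁻ z, f₄ z ∂(volume.restrict Ω).prod volume ≤ ENNReal.ofReal L := by
    refine (lintegral_mono' hle le_rfl).trans ?_
    rw [Measure.volume_eq_prod, lintegral_prod_symm _ hm₄]
    refine le_trans (lintegral_mono fun y => ?_) huL
    change ∫⁻ x, ‖k (x - y) - g (x - y)‖ₑ * ‖u y‖ₑ ≤ _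
    rw [lintegral_mul_const' _ _ enorm_ne_top,
      lintegral_sub_right_eq_self (fun z => ‖k z - g z‖ₑ) y]
    exact mul_le_of_le_one_left (by positivity) hD
  have hpt : ∀ x, ENNReal.ofReal a * ‖u x - ∫ y, g (x - y) / a * u y‖ₑ ≤
      ∫⁻ y, (f₁ (x, y) + f₂ (x, y) + f₃ (x, y) + f₄ (x, y)) := by
    intro x
    have h1 : a * (u x - ∫ y, g (x - y) / a * u y) = ∫ y, g (x - y) * (u x - u y) := by
      have e1 : ∫ y, g (x - y) / a * u y = (∫ y, g (x - y) * u y) / a := by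
        rw [← integral_div]
        congr 1 with y
        ring
      simp_rw [mul_sub]
      rw [integral_sub ((hgi.comp_sub_left x).mul_const _) (integrable_sub_mul hgc hgs hui x),
        integral_mul_const, integral_sub_left_eq_self g, e1]
      field_simp
      rw [ha, mul_comm]
    rw [← ofReal_norm, ← ENNReal.ofReal_mul ha0.le, ← abs_of_pos ha0, ← Real.norm_eq_abs,
      ← norm_mul, Real.norm_of_nonneg ha0.le, h1, ofReal_norm]
    refine (enorm_integral_le_lintegral_enorm _).trans (lintegral_mono_ae ?_)
    have hJx : ∀ᵐ y, 0 < J (x - y) :=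
      (quasiMeasurePreserving_sub_left_of_right_invariant volume x).ae hJ.ae_pos
    filter_upwards [hJx] with y hy
    have hkJ : k (x - y) ≤ J (x - y) := indicator_le_self' (fun _ _ => hy.le) _
    have hky : 0 ≤ k (x - y) := indicator_apply_nonneg (fun _ => hy.le)
    simp only [f₁, f₂, f₃, f₄, ← ofReal_norm, Real.norm_eq_abs]
    rw [← ENNReal.ofReal_mul hC0, ← ENNReal.ofReal_mul (abs_nonneg _),
      ← ENNReal.ofReal_mul (abs_nonneg _), ← ENNReal.ofReal_add (by positivity)
      (mul_nonneg hC0 (mul_nonneg (hΨ.nonneg _) hy.le)), ← ENNReal.ofReal_add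
      (add_nonneg (by positivity) (mul_nonneg hC0 (mul_nonneg (hΨ.nonneg _) hy.le)))
      (by positivity), ← ENNReal.ofReal_add (add_nonneg (add_nonneg (by positivity)
      (mul_nonneg hC0 (mul_nonneg (hΨ.nonneg _) hy.le))) (by positivity)) (by positivity)]
    refine ENNReal.ofReal_le_ofReal ?_
    have e1 := hΨ.abs_le_add_mul hd hq hη0 (u x - u y)
    have e2 : |g (x - y)| ≤ k (x - y) + |k (x - y) - g (x - y)| := by
      have := abs_sub_abs_le_abs_sub (g (x - y)) (k (x - y))
      rw [abs_of_nonneg hky, abs_sub_comm] at this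
      linarith
    have e3 : |u x - u y| ≤ |u x| + |u y| := abs_sub _ _
    have e4 : k (x - y) * |u x - u y| ≤
        η * k (x - y) + C * (Ψ (u x - u y) * J (x - y)) := by
      calc k (x - y) * |u x - u y| ≤ k (x - y) * (η + C * Ψ (u x - u y)) :=
            mul_le_mul_of_nonneg_left e1 hky
        _ = η * k (x - y) + C * Ψ (u x - u y) * k (x - y) := by ring
        _ ≤ η * k (x - y) + C * Ψ (u x - u y) * J (x - y) := by
            gcongr
            exact mul_nonneg hC0 (hΨ.nonneg _)
        _ = _ := by ring
    rw [abs_mul]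
    calc |g (x - y)| * |u x - u y|
        ≤ (k (x - y) + |k (x - y) - g (x - y)|) * |u x - u y| := by gcongr
      _ = k (x - y) * |u x - u y| + |k (x - y) - g (x - y)| * |u x - u y| := by ring
      _ ≤ k (x - y) * |u x - u y| + |k (x - y) - g (x - y)| * (|u x| + |u y|) := by gcongr
      _ ≤ _ := by linarith
  have hmul : ENNReal.ofReal a * ∫⁻ x in Ω, ‖u x - ∫ y, g (x - y) / a * u y‖ₑ ≤
      ENNReal.ofReal a * ENNReal.ofReal ε := by
    calc ENNReal.ofReal a * ∫⁻ x in Ω, ‖u x - ∫ y, g (x - y) / a * u y‖ₑ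
        ≤ ∫⁻ x in Ω, ∫⁻ y, (f₁ (x, y) + f₂ (x, y) + f₃ (x, y) + f₄ (x, y)) := by
          rw [← lintegral_const_mul' _ _ ENNReal.ofReal_ne_top]
          exact lintegral_mono fun x => hpt x
      _ = ∫⁻ z, (f₁ z + f₂ z + f₃ z + f₄ z) ∂(volume.restrict Ω).prod volume :=
          (lintegral_prod _ ((((hm₁.add hm₂).add hm₃).add hm₄).mono_measure hle)).symm
      _ = ∫⁻ z, f₁ z ∂(volume.restrict Ω).prod volume +
          ∫⁻ z, f₂ z ∂(volume.restrict Ω).prod volume +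
          ∫⁻ z, f₃ z ∂(volume.restrict Ω).prod volume +
          ∫⁻ z, f₄ z ∂(volume.restrict Ω).prod volume := by
          rw [lintegral_add_right' _ (hm₄.mono_measure hle),
            lintegral_add_right' _ (hm₃.mono_measure hle),
            lintegral_add_right' _ (hm₂.mono_measure hle)]
      _ ≤ ENNReal.ofReal (η * A * V) + ENNReal.ofReal (2 * C * M) + ENNReal.ofReal L +
          ENNReal.ofReal L := add_le_add (add_le_add (add_le_add hI₁.le hI₂) hI₃) hI₄
      _ = ENNReal.ofReal (η * A * V + 2 * C * M + 2 * L) := by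
          have hA0 : 0 ≤ A := by linarith
          rw [← ENNReal.ofReal_add (by positivity) (by positivity),
            ← ENNReal.ofReal_add (by positivity) hL, ← ENNReal.ofReal_add (by positivity) hL]
          congr 1
          ring
      _ ≤ _ := by
          rw [← ENNReal.ofReal_mul ha0.le, mul_comm a]
          exact ENNReal.ofReal_le_ofReal hfinal
  exact (ENNReal.mul_le_mul_iff_right (by simpa using ha0) ENNReal.ofReal_ne_top).1 hmul

/-- Mollification by a fixed continuous kernel is compact from `L¹` to `L¹(Ω)`: finitely many
classes suffice for functions in the same class to have nearby mollifications. The class of `u` is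
given by the approximate values of its mollification at the points of a finite net of `Ω`. -/
theorem exists_finite_discretization {g : Space N → ℝ} (hgc : Continuous g)
    (hgs : HasCompactSupport g) (hΩb : Bornology.IsBounded Ω) {L ε : ℝ}
    (hL : 0 ≤ L) (hε : 0 < ε) :
    ∃ (β : Type) (_ : Fintype β) (F : {u : Space N → ℝ // Integrable u ∧ ∫ x, ‖u x‖ ≤ L} → β),
      ∀ u v, F u = F v → ∫⁻ x in Ω, ‖(∫ y, g (x - y) * u.1 y) - ∫ y, g (x - y) * v.1 y‖ₑ ≤
        ENNReal.ofReal ε := by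
  have hV : volume Ω ≠ ∞ := hΩb.measure_lt_top.ne
  set V : ℝ := (volume Ω).toReal with hVdef
  have hV0 : 0 ≤ V := ENNReal.toReal_nonneg
  set η : ℝ := ε / (3 * (V + 1)) with hη
  have hη0 : 0 < η := by positivity
  obtain ⟨C, hC⟩ := hgc.bounded_above_of_compact_support hgs
  have hC0 : 0 ≤ C := (norm_nonneg _).trans (hC 0)
  obtain ⟨ρ, hρ, hgρ⟩ := Metric.uniformContinuous_iff.1
    (hgs.uniformContinuous_of_continuous hgc) (η / (L + 1)) (by positivity)
  obtain ⟨t, ht, hcov⟩ := Metric.totallyBounded_iff.1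
    (hΩb.isCompact_closure.totallyBounded.subset subset_closure) ρ hρ
  have := ht.fintype
  let S := {u : Space N → ℝ // Integrable u ∧ ∫ x, ‖u x‖ ≤ L}
  let h : S → Space N → ℝ := fun u x => ∫ y, g (x - y) * u.1 y
  let e : S → t → ℝ := fun u i => h u i
  have he : ∀ u, e u ∈ Metric.closedBall (0 : t → ℝ) (C * L) := by
    intro u
    rw [mem_closedBall_zero_iff, pi_norm_le_iff_of_nonneg (by positivity)]
    intro i
    calc ‖∫ y, g (i - y) * u.1 y‖ ≤ ∫ y, C * ‖u.1 y‖ :=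
          norm_integral_le_of_norm_le (u.2.1.norm.const_mul C) (Eventually.of_forall fun y => by
            rw [norm_mul]; gcongr; exact hC _)
      _ = C * ∫ y, ‖u.1 y‖ := integral_const_mul _ _
      _ ≤ C * L := by gcongr; exact u.2.2
  obtain ⟨s, hs, hscov⟩ := Metric.totallyBounded_iff.1
    (isCompact_closedBall (0 : t → ℝ) (C * L)).totallyBounded
    (η / 2) (by positivity)
  have hex : ∀ u : S, ∃ b : s, dist (e u) b < η / 2 := by
    intro u
    obtain ⟨b, hb, hub⟩ := mem_iUnion₂.1 (hscov (he u))
    exact ⟨⟨b, hb⟩, hub⟩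
  choose F hF using hex
  have hcl : ∀ (u : S) (x i : Space N), dist x i < ρ → |h u x - h u i| ≤ η := by
    intro u x i hxi
    have hg' := integrable_sub_mul hgc hgs u.2.1
    have : h u x - h u i = ∫ y, (g (x - y) - g (i - y)) * u.1 y := by
      simp only [h, sub_mul]
      rw [integral_sub (hg' x) (hg' i)]
    rw [this, ← Real.norm_eq_abs]
    calc ‖∫ y, (g (x - y) - g (i - y)) * u.1 y‖ ≤ ∫ y, η / (L + 1) * ‖u.1 y‖ :=
          norm_integral_le_of_norm_le (u.2.1.norm.const_mul _) (Eventually.of_forall fun y => by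
            rw [norm_mul]
            gcongr
            rw [← dist_eq_norm]
            exact (hgρ (by simpa using hxi)).le)
      _ = η / (L + 1) * ∫ y, ‖u.1 y‖ := integral_const_mul _ _
      _ ≤ η / (L + 1) * (L + 1) := by gcongr; linarith [u.2.2]
      _ = η := by field_simp
  refine ⟨s, hs.fintype, F, fun u v huv => ?_⟩
  have hpt : ∀ x ∈ Ω, ‖h u x - h v x‖ₑ ≤ ENNReal.ofReal (3 * η) := by
    intro x hx
    obtain ⟨i, hi, hxi⟩ := mem_iUnion₂.1 (hcov hx)
    have h1 := hcl u x i hxi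
    have h2 := hcl v x i hxi
    have h3 : |h u i - h v i| ≤ η := by
      have h4 : dist (e u) (e v) ≤ η := by
        have := dist_triangle_right (e u) (e v) (F u)
        have h5 := hF u
        have h6 := hF v
        rw [← huv] at h6
        linarith
      rw [← Real.dist_eq]
      exact (dist_le_pi_dist (e u) (e v) ⟨i, hi⟩).trans h4
    rw [← ofReal_norm, Real.norm_eq_abs]
    refine ENNReal.ofReal_le_ofReal ?_
    rw [abs_le] at *
    constructor <;> linarith [h1.1, h1.2, h2.1, h2.2, h3.1, h3.2]
  calc ∫⁻ x in Ω, ‖h u x - h v x‖ₑ ≤ ∫⁻ x in Ω, ENNReal.ofReal (3 * η) :=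
        setLIntegral_mono measurable_const hpt
    _ = ENNReal.ofReal (3 * η * V) := by
        rw [setLIntegral_const, ENNReal.ofReal_mul (show 0 ≤ 3 * η by positivity), hVdef,
          ENNReal.ofReal_toReal hV]
    _ ≤ ENNReal.ofReal ε := by
        refine ENNReal.ofReal_le_ofReal ?_
        rw [hη, mul_div_assoc', div_mul_eq_mul_div, div_le_iff₀ (by positivity)]
        nlinarith

/-- A sequence of bounded energy has a subsequence converging almost everywhere in `Ω`. -/
theorem exists_subseq_tendsto_ae (hJ : IsKernel J) (hΨ : IsGamma p q Ψ)
    (hd : ∀ s, HasDerivAt Ψ (ψ s) s) (hq : 1 < q) (hΩo : IsOpen Ω)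
    (hΩb : Bornology.IsBounded Ω) {u : ℕ → Space N → ℝ} (hu : ∀ n, u n ∈ W₀ J Ψ Ω) {M : ℝ}
    (hM : 0 ≤ M) (huM : ∀ n, energyE J Ψ (u n) ≤ ENNReal.ofReal M) :
    ∃ (φ : ℕ → ℕ) (v : Space N → ℝ), StrictMono φ ∧ AEMeasurable v (volume.restrict Ω) ∧
      ∀ᵐ x ∂volume.restrict Ω, Tendsto (fun n => u (φ n) x) atTop (𝓝 (v x)) := by
  obtain ⟨C, hC, hP⟩ := modularF_le_energyE hJ hΨ (continuous_growth hd) hΩb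
  have hLfin : volume Ω + C * ENNReal.ofReal M ≠ ∞ :=
    ENNReal.add_ne_top.2 ⟨hΩb.measure_lt_top.ne, ENNReal.mul_ne_top hC ENNReal.ofReal_ne_top⟩
  set L : ℝ := (volume Ω + C * ENNReal.ofReal M).toReal with hL
  have hL0 : 0 ≤ L := ENNReal.toReal_nonneg
  have hui : ∀ n, Integrable (u n) := fun n => integrable_of_mem_W₀ hΨ hd hq hΩo hΩb (hu n)
  have huL : ∀ n, ∫⁻ x, ‖u n x‖ₑ ≤ ENNReal.ofReal L := by
    intro n
    rw [hL, ENNReal.ofReal_toReal hLfin]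
    refine (lintegral_enorm_le hΨ hd hq hΩo (hu n)).trans ?_
    gcongr
    exact (hP _ (hu n)).trans (by gcongr; exact huM n)
  have huL' : ∀ n, ∫ x, ‖u n x‖ ≤ L := by
    intro n
    rw [integral_norm_eq_lintegral_enorm (hui n).aestronglyMeasurable]
    exact ENNReal.toReal_le_of_le_ofReal hL0 (huL n)
  let U : ℕ → Lp ℝ 1 (volume.restrict Ω) := fun n => (hui n).integrableOn.toL1 (u n)
  have htb : TotallyBounded (range U) := by
    refine Metric.totallyBounded_of_finite_discretization fun ε hε => ?_
    obtain ⟨g, hgc, hgs, hg⟩ := exists_mollifier hJ hΨ hd hq hΩo hΩb hM hL0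
      (show 0 < ε / 4 by positivity)
    obtain ⟨β, hβ, F, hF⟩ := exists_finite_discretization hgc hgs hΩb hL0
      (show 0 < ε / 4 by positivity)
    let idx : range U → ℕ := fun x => x.2.choose
    have hidx : ∀ x : range U, U (idx x) = x := fun x => x.2.choose_spec
    refine ⟨β, hβ, fun x => F ⟨u (idx x), hui _, huL' _⟩, fun x y hxy => ?_⟩
    have h1 := hF _ _ hxy
    have h2 := hg _ (hu (idx x)) (huM _) (huL _)
    have h3 := hg _ (hu (idx y)) (huM _) (huL _)
    rw [← hidx x, ← hidx y]
    have hm : ∀ n, AEMeasurable (fun x => ∫ y, g (x - y) * u n y) (volume.restrict Ω) := fun n =>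
      (aestronglyMeasurable_integral_sub_mul hgc (hu n).1 _
        Measure.restrict_le_self.absolutelyContinuous).aemeasurable
    have h4 : edist (U (idx x)) (U (idx y)) ≤ ENNReal.ofReal (3 * (ε / 4)) := by
      refine (Integrable.edist_toL1_toL1 _ _ _ _).trans_le ?_
      calc ∫⁻ z in Ω, edist (u (idx x) z) (u (idx y) z)
          ≤ ∫⁻ z in Ω, (‖u (idx x) z - ∫ y, g (z - y) * u (idx x) y‖ₑ +
              ‖(∫ w, g (z - w) * u (idx x) w) - ∫ w, g (z - w) * u (idx y) w‖ₑ +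
              ‖u (idx y) z - ∫ w, g (z - w) * u (idx y) w‖ₑ) := by
            refine lintegral_mono fun z => ?_
            rw [← edist_eq_enorm_sub, ← edist_eq_enorm_sub, ← edist_eq_enorm_sub,
              edist_comm (u (idx y) z)]
            exact edist_triangle4 _ _ _ _
        _ ≤ ENNReal.ofReal (ε / 4) + ENNReal.ofReal (ε / 4) + ENNReal.ofReal (ε / 4) := by
            have m₁ : AEMeasurable (fun z => ‖(∫ w, g (z - w) * u (idx x) w) -
                ∫ w, g (z - w) * u (idx y) w‖ₑ) (volume.restrict Ω) := ((hm _).sub (hm _)).enorm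
            have m₂ : AEMeasurable (fun z => ‖u (idx y) z - ∫ w, g (z - w) * u (idx y) w‖ₑ)
                (volume.restrict Ω) := ((hu _).1.restrict.sub (hm _)).enorm
            rw [lintegral_add_right' _ m₂, lintegral_add_right' _ m₁]
            exact add_le_add (add_le_add h2 h1) h3
        _ = _ := by
            rw [← ENNReal.ofReal_add (by positivity) (by positivity),
              ← ENNReal.ofReal_add (by positivity) (by positivity)]
            congr 1
            ring
    have h5 : dist (U (idx x)) (U (idx y)) ≤ 3 * (ε / 4) := by
      rw [edist_dist] at h4
      exact (ENNReal.ofReal_le_ofReal_iff (by positivity)).1 h4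
    linarith
  have hcomp : IsCompact (closure (range U)) :=
    isCompact_iff_totallyBounded_isComplete.2 ⟨htb.closure, isClosed_closure.isComplete⟩
  obtain ⟨v, -, φ, hφ, hlim⟩ :=
    hcomp.tendsto_subseq (x := U) fun n => subset_closure (mem_range_self n)
  obtain ⟨ns, hns, hae⟩ := (tendstoInMeasure_of_tendsto_Lp hlim).exists_seq_tendsto_ae
  refine ⟨φ ∘ ns, v, hφ.comp hns, (Lp.aestronglyMeasurable v).aemeasurable, ?_⟩
  have hco : ∀ᵐ x ∂volume.restrict Ω, ∀ n, U n x = u n x :=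
    ae_all_iff.2 fun n => Integrable.coeFn_toL1 _
  filter_upwards [hae, hco] with x hx hx'
  simpa [hx'] using hx

end Compactness

/-! ### The reaction term -/

section Reaction

variable {N : ℕ} {p q μ c : ℝ} {J : Space N → ℝ} {ψ Ψ f : ℝ → ℝ} {Ω : Set (Space N)}

theorem continuous_comp_abs (hf : ContinuousOn f (Ici 0)) : Continuous fun t => f |t| :=
  hf.comp_continuous continuous_abs fun _ => mem_Ici.2 (abs_nonneg _)

theorem primitiveG_eq (f : ℝ → ℝ) (t : ℝ) : primitiveG f t = ∫ s in (0 : ℝ)..|t|, f |s| := by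
  refine intervalIntegral.integral_congr fun s hs => ?_
  rw [uIcc_of_le (abs_nonneg t)] at hs
  simp only [abs_of_nonneg hs.1]

theorem hasDerivAt_primitive (hf : ContinuousOn f (Ici 0)) (r : ℝ) :
    HasDerivAt (fun r => ∫ s in (0 : ℝ)..r, f |s|) (f |r|) r :=
  (continuous_comp_abs hf).integral_hasStrictDerivAt 0 r |>.hasDerivAt

theorem continuous_primitiveG (hf : ContinuousOn f (Ici 0)) : Continuous (primitiveG f) := by
  have h : Continuous fun r => ∫ s in (0 : ℝ)..r, f |s| :=
    continuous_iff_continuousAt.2 fun r => (hasDerivAt_primitive hf r).continuousAt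
  refine (h.comp continuous_abs).congr fun t => ?_
  rw [primitiveG_eq]
  rfl

theorem primitiveG_abs (f : ℝ → ℝ) (t : ℝ) : primitiveG f |t| = primitiveG f t := by
  rw [primitiveG, primitiveG, abs_abs]

theorem abs_reaction_le (hΨ : IsGamma p q Ψ) (hμ0 : 0 < μ) (hc : 0 ≤ c)
    (hg : ∀ t, 0 ≤ t → |f t| ≤ c * (1 + Ψ t ^ μ)) {s m : ℝ} (hsm : |s| ≤ |m|) :
    |f (|s|)| ≤ c * (1 + Ψ m ^ μ) := by
  refine (hg _ (abs_nonneg s)).trans ?_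
  have h1 : Ψ |s| ≤ Ψ m := hΨ.mono_abs (by rwa [abs_abs])
  have := Real.rpow_le_rpow (hΨ.nonneg _) h1 hμ0.le
  gcongr

theorem abs_primitiveG_sub_le (hΨ : IsGamma p q Ψ) (hf : ContinuousOn f (Ici 0)) (hμ0 : 0 < μ)
    (hc : 0 ≤ c) (hg : ∀ t, 0 ≤ t → |f t| ≤ c * (1 + Ψ t ^ μ)) {s t m : ℝ} (hs : |s| ≤ |m|)
    (ht : |t| ≤ |m|) : |primitiveG f s - primitiveG f t| ≤ c * (1 + Ψ m ^ μ) * |s - t| := by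
  have hi : ∀ a b : ℝ, IntervalIntegrable (fun s => f |s|) volume a b := fun a b =>
    (continuous_comp_abs hf).intervalIntegrable a b
  rw [primitiveG_eq, primitiveG_eq, intervalIntegral.integral_interval_sub_left (hi _ _) (hi _ _)]
  have h := intervalIntegral.norm_integral_le_of_norm_le_const (a := |t|) (b := |s|)
    (f := fun s => f |s|) (C := c * (1 + Ψ m ^ μ)) fun x hx => by
      refine abs_reaction_le hΨ hμ0 hc hg ?_
      rcases hx with ⟨h1, h2⟩
      rw [abs_of_nonneg ((le_min (abs_nonneg _) (abs_nonneg _)).trans h1.le)]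
      exact h2.trans (max_le ht hs)
  refine h.trans (mul_le_mul_of_nonneg_left (abs_abs_sub_abs_le_abs_sub s t) ?_)
  have := Real.rpow_nonneg (hΨ.nonneg m) μ
  positivity

theorem primitiveG_zero (f : ℝ → ℝ) : primitiveG f 0 = 0 := by
  simp [primitiveG]

theorem abs_primitiveG_le (hΨ : IsGamma p q Ψ) (hf : ContinuousOn f (Ici 0)) (hμ0 : 0 < μ)
    (hc : 0 ≤ c) (hg : ∀ t, 0 ≤ t → |f t| ≤ c * (1 + Ψ t ^ μ)) (t : ℝ) :
    |primitiveG f t| ≤ |t| * (c * (1 + Ψ t ^ μ)) := by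
  have := abs_primitiveG_sub_le hΨ hf hμ0 hc hg (s := t) (t := 0) (m := t) le_rfl (by simp)
  rw [primitiveG_zero, sub_zero, sub_zero] at this
  linarith

theorem integrableOn_primitiveG (hJ : IsKernel J) (hΨ : IsGamma p q Ψ)
    (hd : ∀ s, HasDerivAt Ψ (ψ s) s) (hq : 1 < q) (hqp : q ≤ p)
    (hΩb : Bornology.IsBounded Ω) (hf : ContinuousOn f (Ici 0)) (hμ0 : 0 < μ)
    (hμ : μ < (q - 1) / p) (hc : 0 ≤ c) (hg : ∀ t, 0 ≤ t → |f t| ≤ c * (1 + Ψ t ^ μ))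
    {v : Space N → ℝ} (hv : v ∈ W₀ J Ψ Ω) :
    IntegrableOn (fun x => primitiveG f (v x)) Ω := by
  obtain ⟨C, -, hC⟩ := hΨ.subcritical hd hq hqp hμ0 hμ hc one_pos
  have h1 := (mem_W₀_iff hJ hΨ (continuous_growth hd)).1 hv
  refine ((h1.2.1.const_mul 1).integrableOn.add
    (integrableOn_const (C := C) hΩb.measure_lt_top.ne)).mono'
    ((continuous_primitiveG hf).measurable.comp_aemeasurable hv.1).aestronglyMeasurable.restrict
    (Eventually.of_forall fun x => ?_)
  exact (abs_primitiveG_le hΨ hf hμ0 hc hg (v x)).trans (hC (v x))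

theorem toReal_modularF (hΨ : IsGamma p q Ψ) (hc : Continuous Ψ)
    {u : Space N → ℝ} (hu : AEMeasurable u) : (modularF Ψ u).toReal = ∫ x, Ψ (u x) := by
  rw [integral_eq_lintegral_of_nonneg_ae (Eventually.of_forall fun x => hΨ.nonneg _)
    (aemeasurable_growth hc hu).aestronglyMeasurable, modularF]

/-- Fatou's lemma for nonnegative real functions whose integrals are bounded by a convergent
sequence. -/
theorem integrable_and_integral_le_of_tendsto {α : Type*} [MeasurableSpace α] {ν : Measure α}
    {X : ℕ → α → ℝ} {Y : α → ℝ} {b : ℕ → ℝ} {B : ℝ} (hX : ∀ n, Integrable (X n) ν)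
    (h0 : ∀ n, 0 ≤ᵐ[ν] X n) (hlim : ∀ᵐ x ∂ν, Tendsto (fun n => X n x) atTop (𝓝 (Y x)))
    (hb : ∀ n, ∫ x, X n x ∂ν ≤ b n) (hB : Tendsto b atTop (𝓝 B)) :
    Integrable Y ν ∧ ∫ x, Y x ∂ν ≤ B := by
  have hYm : AEStronglyMeasurable Y ν :=
    aestronglyMeasurable_of_tendsto_ae atTop (fun n => (hX n).aestronglyMeasurable) hlim
  have hY0 : 0 ≤ᵐ[ν] Y := by
    filter_upwards [hlim, ae_all_iff.2 h0] with x hx hx0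
    exact ge_of_tendsto' hx hx0
  have hB0 : 0 ≤ B := ge_of_tendsto' hB fun n => (integral_nonneg_of_ae (h0 n)).trans (hb n)
  have key : ∫⁻ x, ENNReal.ofReal (Y x) ∂ν ≤ ENNReal.ofReal B := by
    calc ∫⁻ x, ENNReal.ofReal (Y x) ∂ν
        = ∫⁻ x, liminf (fun n => ENNReal.ofReal (X n x)) atTop ∂ν := by
          refine lintegral_congr_ae ?_
          filter_upwards [hlim] with x hx
          exact ((ENNReal.tendsto_ofReal hx).liminf_eq).symm
      _ ≤ liminf (fun n => ∫⁻ x, ENNReal.ofReal (X n x) ∂ν) atTop :=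
          lintegral_liminf_le' fun n => (hX n).aestronglyMeasurable.aemeasurable.ennreal_ofReal
      _ ≤ liminf (fun n => ENNReal.ofReal (b n)) atTop := by
          refine liminf_le_liminf (Eventually.of_forall fun n => ?_)
          rw [← ofReal_integral_eq_lintegral_ofReal (hX n) (h0 n)]
          exact ENNReal.ofReal_le_ofReal (hb n)
      _ = ENNReal.ofReal B := (ENNReal.tendsto_ofReal hB).liminf_eq
  refine ⟨(lintegral_ofReal_ne_top_iff_integrable hYm hY0).1
    (key.trans_lt ENNReal.ofReal_lt_top).ne, ?_⟩
  rw [integral_eq_lintegral_of_nonneg_ae hY0 hYm]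
  exact ENNReal.toReal_le_of_le_ofReal hB0 key

/-! ### Existence of a minimizer -/

theorem exists_poincare (hJ : IsKernel J) (hΨ : IsGamma p q Ψ) (hc : Continuous Ψ)
    (hΩb : Bornology.IsBounded Ω) :
    ∃ C : ℝ, 0 ≤ C ∧ ∀ u ∈ W₀ J Ψ Ω, ∫ x, Ψ (u x) ≤ C * (energyE J Ψ u).toReal := by
  obtain ⟨C, hC, hP⟩ := modularF_le_energyE hJ hΨ hc hΩb
  refine ⟨C.toReal, ENNReal.toReal_nonneg, fun u hu => ?_⟩
  rw [← toReal_modularF hΨ hc hu.1, ← ENNReal.toReal_mul]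
  exact ENNReal.toReal_mono (ENNReal.mul_ne_top hC hu.2.2.1.ne) (hP u hu)

/-- The direct method. The limit of a minimizing sequence is set to zero outside `Ω`, and its
absolute value is the minimizer. -/
theorem exists_minimizer (hJ : IsKernel J) (hΨ : IsGamma p q Ψ)
    (hd : ∀ s, HasDerivAt Ψ (ψ s) s) (hq : 1 < q) (hqp : q ≤ p) (hΩo : IsOpen Ω)
    (hΩb : Bornology.IsBounded Ω) (hf : ContinuousOn f (Ici 0)) (hμ0 : 0 < μ)
    (hμ : μ < (q - 1) / p) (hc : 0 ≤ c) (hg : ∀ t, 0 ≤ t → |f t| ≤ c * (1 + Ψ t ^ μ)) :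
    ∃ u ∈ W₀ J Ψ Ω, (∀ x, 0 ≤ u x) ∧
      ∀ v ∈ W₀ J Ψ Ω, functionalI J Ψ Ω f u ≤ functionalI J Ψ Ω f v := by
  have hcont := continuous_growth hd
  have hGi := fun (v : Space N → ℝ) (hv : v ∈ W₀ J Ψ Ω) =>
    integrableOn_primitiveG hJ hΨ hd hq hqp hΩb hf hμ0 hμ hc hg hv
  have hmem := fun (v : Space N → ℝ) (hv : v ∈ W₀ J Ψ Ω) => (mem_W₀_iff hJ hΨ hcont).1 hv
  have hVt : volume Ω ≠ ∞ := hΩb.measure_lt_top.ne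
  obtain ⟨P, hP0, hP⟩ := exists_poincare hJ hΨ hcont hΩb (Ω := Ω)
  have hGle : ∀ (C ε : ℝ), (∀ t, |t| * (c * (1 + Ψ t ^ μ)) ≤ ε * Ψ t + C) →
      ∀ t, 0 ≤ ε * Ψ t + C - primitiveG f t := fun C ε h t => by
    have := (le_abs_self _).trans ((abs_primitiveG_le hΨ hf hμ0 hc hg t).trans (h t))
    linarith
  -- Coercivity: the reaction is absorbed into half of the energy.
  have hcoer : ∃ D : ℝ, ∀ v ∈ W₀ J Ψ Ω,
      (energyE J Ψ v).toReal / 2 - D ≤ functionalI J Ψ Ω f v := by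
    set ε : ℝ := 1 / (2 * (P + 1)) with hε
    have hε0 : 0 < ε := by positivity
    obtain ⟨C, -, hC⟩ := hΨ.subcritical hd hq hqp hμ0 hμ hc hε0
    refine ⟨volume.real Ω * C, fun v hv => ?_⟩
    have h1 := setIntegral_mono (hGi v hv)
      (((hmem v hv).2.1.const_mul ε).integrableOn.add (integrableOn_const (C := C) hVt))
      fun x => sub_nonneg.1 (hGle C ε hC (v x))
    have h2 : ∫ x in Ω, (ε * Ψ (v x) + C) = ε * (∫ x in Ω, Ψ (v x)) + volume.real Ω * C := by
      rw [integral_add ((hmem v hv).2.1.const_mul ε).integrableOn (integrableOn_const (C := C) hVt),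
        integral_const_mul, setIntegral_const, smul_eq_mul]
    have h3 : ∫ x in Ω, Ψ (v x) ≤ P * (energyE J Ψ v).toReal :=
      (setIntegral_le_integral (hmem v hv).2.1
        (Eventually.of_forall fun x => hΨ.nonneg _)).trans (hP v hv)
    have h4 : ε * (P * (energyE J Ψ v).toReal) ≤ (energyE J Ψ v).toReal / 2 := by
      rw [hε, div_mul_eq_mul_div, div_le_iff₀ (by positivity)]
      nlinarith [ENNReal.toReal_nonneg (a := energyE J Ψ v)]
    have h5 := mul_le_mul_of_nonneg_left h3 hε0.le
    have h6 : ∫ x in Ω, primitiveG f (v x) ≤ ∫ x in Ω, (ε * Ψ (v x) + C) := h1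
    rw [functionalI]
    linarith
  obtain ⟨D, hD⟩ := hcoer
  have h0W : (fun _ => 0 : Space N → ℝ) ∈ W₀ J Ψ Ω := by
    rw [mem_W₀_iff hJ hΨ hcont]
    simp [hΨ.zero]
  let A : Set ℝ := functionalI J Ψ Ω f '' W₀ J Ψ Ω
  have hAne : A.Nonempty := ⟨_, _, h0W, rfl⟩
  have hAb : BddBelow A := ⟨-D, by
    rintro _ ⟨v, hv, rfl⟩
    linarith [hD v hv, ENNReal.toReal_nonneg (a := energyE J Ψ v)]⟩
  obtain ⟨a, -, ha, haA⟩ := exists_seq_tendsto_sInf hAne hAb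
  choose u₀ hu₀ hua using haA
  obtain ⟨M, hM⟩ := ha.bddAbove_range
  have hE₀ : ∀ n, (energyE J Ψ (u₀ n)).toReal ∈ Icc 0 (max 0 (2 * (M + D))) := fun n => by
    have h1 : a n ≤ M := hM (mem_range_self n)
    rw [← hua n] at h1
    exact ⟨ENNReal.toReal_nonneg, le_max_of_le_right (by linarith [hD _ (hu₀ n)])⟩
  set M' : ℝ := max 0 (2 * (M + D)) with hM'
  have hM'0 : 0 ≤ M' := le_max_left _ _
  obtain ⟨e, he, φ, hφ, hφe⟩ := isCompact_Icc.tendsto_subseq hE₀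
  obtain ⟨φ', v, hφ', hvm, hv⟩ := exists_subseq_tendsto_ae hJ hΨ hd hq hΩo hΩb
    (u := fun n => u₀ (φ n)) (fun n => hu₀ _) hM'0 fun n =>
      (ENNReal.le_ofReal_iff_toReal_le (hu₀ _).2.2.1.ne hM'0).2 (hE₀ _).2
  -- The minimizing sequence, after both extractions, and its limit.
  let u : ℕ → Space N → ℝ := fun n => u₀ (φ (φ' n))
  have hu : ∀ n, u n ∈ W₀ J Ψ Ω := fun n => hu₀ _
  let w : Space N → ℝ := Ω.indicator v
  have huE : Tendsto (fun n => (energyE J Ψ (u n)).toReal) atTop (𝓝 e) :=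
    hφe.comp hφ'.tendsto_atTop
  have huI : Tendsto (fun n => functionalI J Ψ Ω f (u n)) atTop (𝓝 (sInf A)) := by
    simp only [u, hua]
    exact ha.comp (hφ.tendsto_atTop.comp hφ'.tendsto_atTop)
  have hwm : AEMeasurable w := (aemeasurable_indicator_iff hΩo.measurableSet).2 hvm
  have hlim : ∀ᵐ x, Tendsto (fun n => u n x) atTop (𝓝 (w x)) := by
    rw [ae_restrict_iff' hΩo.measurableSet] at hv
    filter_upwards [hv, ae_all_iff.2 fun n => (hu n).2.2.2] with x hx hx0
    by_cases hxΩ : x ∈ Ω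
    · simp only [w, indicator_of_mem hxΩ]
      exact hx hxΩ
    · simp only [w, indicator_of_notMem hxΩ, fun n => hx0 n hxΩ]
      exact tendsto_const_nhds
  have hlim₂ : ∀ᵐ z : Space N × Space N, Tendsto
      (fun n => Ψ (u n z.1 - u n z.2) * J (z.1 - z.2)) atTop
      (𝓝 (Ψ (w z.1 - w z.2) * J (z.1 - z.2))) := by
    filter_upwards [Measure.quasiMeasurePreserving_fst.ae hlim,
      Measure.quasiMeasurePreserving_snd.ae hlim] with z h1 h2
    exact ((hcont.tendsto _).comp (h1.sub h2)).mul_const _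
  have hFu : ∀ n, ∫ x, Ψ (u n x) ≤ P * M' := fun n =>
    (hP _ (hu n)).trans (mul_le_mul_of_nonneg_left (hE₀ _).2 hP0)
  have hFw := integrable_and_integral_le_of_tendsto (fun n => (hmem _ (hu n)).2.1)
    (fun n => Eventually.of_forall fun x => hΨ.nonneg _)
    (hlim.mono fun x hx => (hcont.tendsto _).comp hx) hFu tendsto_const_nhds
  have hEw := integrable_and_integral_le_of_tendsto (fun n => (hmem _ (hu n)).2.2.1)
    (fun n => ae_energy_nonneg hJ hΨ _) hlim₂
    (b := fun n => 2 * (energyE J Ψ (u n)).toReal)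
    (fun n => by rw [toReal_energyE hJ hΨ hcont (hu n).1]; linarith) (huE.const_mul 2)
  have hw : w ∈ W₀ J Ψ Ω := (mem_W₀_iff hJ hΨ hcont).2 ⟨hwm, hFw.1, hEw.1,
    Eventually.of_forall fun x hx => indicator_of_notMem hx _⟩
  have hEw' : (energyE J Ψ w).toReal ≤ e := by
    rw [toReal_energyE hJ hΨ hcont hwm]; linarith [hEw.2]
  have hGlim : Tendsto (fun n => ∫ x in Ω, primitiveG f (u n x)) atTop (𝓝 (e - sInf A)) := by
    refine (huE.sub huI).congr fun n => ?_
    rw [functionalI]; ring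
  -- Fatou's lemma for `C + ε Ψ - G` gives upper semicontinuity of the reaction up to `O(ε)`.
  have hGw : ∀ ε > 0, e - sInf A ≤ (∫ x in Ω, primitiveG f (w x)) + ε * (P * M') := by
    intro ε hε
    obtain ⟨C, -, hC⟩ := hΨ.subcritical hd hq hqp hμ0 hμ hc hε
    have hi : ∀ v ∈ W₀ J Ψ Ω, IntegrableOn (fun x => ε * Ψ (v x) + C) Ω := fun v hv =>
      ((hmem v hv).2.1.const_mul ε).integrableOn.add (integrableOn_const (C := C) hVt)
    have hval : ∀ v ∈ W₀ J Ψ Ω, ∫ x in Ω, (ε * Ψ (v x) + C - primitiveG f (v x)) =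
        ε * (∫ x in Ω, Ψ (v x)) + volume.real Ω * C - ∫ x in Ω, primitiveG f (v x) := by
      intro v hv
      rw [integral_sub (hi v hv) (hGi v hv), integral_add ((hmem v hv).2.1.const_mul ε).integrableOn
        (integrableOn_const (C := C) hVt), integral_const_mul, setIntegral_const, smul_eq_mul]
    have h1 := integrable_and_integral_le_of_tendsto
      (X := fun n x => ε * Ψ (u n x) + C - primitiveG f (u n x))
      (Y := fun x => ε * Ψ (w x) + C - primitiveG f (w x)) (ν := volume.restrict Ω)
      (b := fun n => ε * (P * M') + volume.real Ω * C - ∫ x in Ω, primitiveG f (u n x))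
      (fun n => (hi _ (hu n)).sub (hGi _ (hu n)))
      (fun n => Eventually.of_forall fun x => hGle C ε hC _)
      ((ae_restrict_of_ae hlim).mono fun x hx =>
        ((((hcont.tendsto _).comp hx).const_mul ε).add_const C).sub
          (((continuous_primitiveG hf).tendsto _).comp hx))
      (fun n => by
        rw [hval _ (hu n)]
        have : ∫ x in Ω, Ψ (u n x) ≤ P * M' := (setIntegral_le_integral (hmem _ (hu n)).2.1
          (Eventually.of_forall fun x => hΨ.nonneg _)).trans (hFu n)
        gcongr)
      (hGlim.const_sub _)
    have h2 := h1.2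
    rw [hval w hw] at h2
    have h3 : 0 ≤ ∫ x in Ω, Ψ (w x) := integral_nonneg fun x => hΨ.nonneg _
    nlinarith
  have hGw' : e - sInf A ≤ ∫ x in Ω, primitiveG f (w x) := by
    refine le_of_forall_pos_le_add fun δ hδ => ?_
    have hPM : 0 ≤ P * M' := by positivity
    refine (hGw (δ / (P * M' + 1)) (by positivity)).trans ?_
    gcongr
    rw [div_mul_eq_mul_div, div_le_iff₀ (by positivity)]
    nlinarith
  refine ⟨fun x => |w x|, abs_mem_W₀ hJ hΨ hcont hw, fun x => abs_nonneg _, fun v' hv' => ?_⟩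
  have h1 : (energyE J Ψ fun x => |w x|).toReal ≤ (energyE J Ψ w).toReal :=
    ENNReal.toReal_mono hw.2.2.1.ne (energyE_abs_le hJ hΨ w)
  have h2 : sInf A ≤ functionalI J Ψ Ω f v' := csInf_le hAb ⟨v', hv', rfl⟩
  rw [functionalI]
  simp only [primitiveG_abs]
  linarith

end Reaction

/-! ### Negative energy -/

section NegativeEnergy

variable {N : ℕ} {p q μ c : ℝ} {J : Space N → ℝ} {ψ Ψ f : ℝ → ℝ} {Ω : Set (Space N)}

/-- The cone of height and radius `r` over the point `x₀`. -/
noncomputable def cone (x₀ : Space N) (r : ℝ) (x : Space N) : ℝ := max 0 (r - ‖x - x₀‖)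

theorem continuous_cone (x₀ : Space N) (r : ℝ) : Continuous (cone x₀ r) := by
  unfold cone
  fun_prop

theorem cone_nonneg (x₀ : Space N) (r : ℝ) (x : Space N) : 0 ≤ cone x₀ r x := le_max_left _ _

theorem cone_le (x₀ : Space N) {r : ℝ} (hr : 0 ≤ r) (x : Space N) : cone x₀ r x ≤ r :=
  max_le hr (sub_le_self _ (norm_nonneg _))

theorem cone_eq_zero (x₀ : Space N) {r : ℝ} {x : Space N} (hx : x ∉ Metric.ball x₀ r) :
    cone x₀ r x = 0 := by
  rw [mem_ball_iff_norm, not_lt] at hx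
  exact max_eq_left (by linarith)

theorem abs_cone_sub_le (x₀ : Space N) (r : ℝ) (x y : Space N) :
    |cone x₀ r x - cone x₀ r y| ≤ ‖x - y‖ := by
  refine (abs_max_sub_max_le_max _ _ _ _).trans (max_le (by simp) ?_)
  rw [show r - ‖x - x₀‖ - (r - ‖y - x₀‖) = ‖y - x₀‖ - ‖x - x₀‖ by ring, abs_sub_comm]
  simpa using abs_norm_sub_norm_le (x - x₀) (y - x₀)

theorem IsGamma.le_rpow (hΨ : IsGamma p q Ψ) (hd : ∀ s, HasDerivAt Ψ (ψ s) s) (hq : 1 < q)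
    {s : ℝ} (hs : |s| ≤ 1) : Ψ s ≤ |s| ^ q := by
  rcases eq_or_ne s 0 with rfl | h0
  · rw [hΨ.zero]; positivity
  · simpa [hΨ.one, hΨ.map_abs] using hΨ.scale_le hd hq (abs_pos.2 h0) hs 1

/-- Since `Ψ s ≤ |s| ^ q` for `|s| ≤ 1` and `J` has a finite moment of an order below `q`, cones
have finite energy. -/
theorem cone_mem_W₀ (hJ : IsKernel J) (hΨ : IsGamma p q Ψ)
    (hd : ∀ s, HasDerivAt Ψ (ψ s) s) (hq : max (qStar J) 1 < q) {x₀ : Space N} {r : ℝ}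
    (hr0 : 0 < r) (hr1 : r ≤ 1) (hball : Metric.ball x₀ r ⊆ Ω) : cone x₀ r ∈ W₀ J Ψ Ω := by
  have hc := continuous_growth hd
  have hq1 : 1 < q := (le_max_right _ _).trans_lt hq
  obtain ⟨r₀, ⟨hr₀, hK⟩, hr₀q⟩ := exists_lt_of_csInf_lt
    (s := {q₀ : ℝ | 0 < q₀ ∧ Integrable (fun z => min 1 (‖z‖ ^ q₀) * J z) volume})
    hJ.exists_moment ((le_max_left _ _).trans_lt hq)
  set K : Space N → ℝ := fun z => min 1 (‖z‖ ^ r₀) * J z with hKdef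
  set B := Metric.ball x₀ r with hB
  have hmeas := (continuous_cone x₀ r).measurable.aemeasurable (μ := (volume : Measure (Space N)))
  have hBfin : volume B ≠ ∞ := measure_ball_lt_top.ne
  have hind : Integrable (B.indicator (fun _ => (1 : ℝ)) : Space N → ℝ) :=
    (integrable_indicator_iff measurableSet_ball).2 (integrableOn_const hBfin)
  rw [mem_W₀_iff hJ hΨ hc]
  refine ⟨hmeas, ?_, ?_, Eventually.of_forall fun x hx => cone_eq_zero _ fun h => hx (hball h)⟩
  · refine hind.mono' (aemeasurable_growth hc hmeas).aestronglyMeasurable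
      (Eventually.of_forall fun x => ?_)
    rw [Real.norm_of_nonneg (hΨ.nonneg _)]
    by_cases hx : x ∈ B
    · rw [indicator_of_mem hx, ← hΨ.one]
      refine hΨ.mono_abs ?_
      rw [abs_of_nonneg (cone_nonneg _ _ _), abs_one]
      exact (cone_le x₀ hr0.le x).trans hr1
    · rw [indicator_of_notMem hx, cone_eq_zero _ hx, hΨ.zero]
  · have h2 : Integrable (fun z : Space N × Space N =>
        B.indicator (fun _ => (1 : ℝ)) z.2 * K (z.1 - z.2)) (volume.prod volume) :=
      hind.convolution_integrand (ContinuousLinearMap.mul ℝ ℝ) hK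
    have h1 : Integrable (fun z : Space N × Space N =>
        B.indicator (fun _ => (1 : ℝ)) z.1 * K (z.1 - z.2)) (volume.prod volume) := by
      refine h2.swap.congr (Eventually.of_forall fun z => ?_)
      simp only [Function.comp_apply, Prod.fst_swap, Prod.snd_swap, hKdef]
      rw [← neg_sub z.1 z.2, norm_neg, hJ.symm]
    refine (h1.add h2).mono' (aemeasurable_energy hJ hc hmeas).aestronglyMeasurable ?_
    filter_upwards [hJ.ae_pair_pos] with z hz
    rw [Real.norm_of_nonneg (mul_nonneg (hΨ.nonneg _) hz.le)]
    have hs1 : |cone x₀ r z.1 - cone x₀ r z.2| ≤ 1 := by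
      rw [abs_le]
      constructor <;> linarith [cone_nonneg x₀ r z.1, cone_nonneg x₀ r z.2,
        cone_le x₀ hr0.le z.1, cone_le x₀ hr0.le z.2]
    have hs2 := abs_cone_sub_le x₀ r z.1 z.2
    have hmin : Ψ (cone x₀ r z.1 - cone x₀ r z.2) ≤ min 1 (‖z.1 - z.2‖ ^ r₀) := by
      refine (hΨ.le_rpow hd hq1 hs1).trans 
        (le_min (Real.rpow_le_one (abs_nonneg _) hs1 (by linarith)) ?_)
      rcases eq_or_lt_of_le (abs_nonneg (cone x₀ r z.1 - cone x₀ r z.2)) with h0 | h0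
      · rw [← h0, Real.zero_rpow (by linarith)]
        positivity
      · exact (Real.rpow_le_rpow_of_exponent_ge h0 hs1 hr₀q.le).trans
          (Real.rpow_le_rpow h0.le hs2 hr₀.le)
    have hle : Ψ (cone x₀ r z.1 - cone x₀ r z.2) * J (z.1 - z.2) ≤ K (z.1 - z.2) :=
      mul_le_mul_of_nonneg_right hmin hz.le
    have hK0 : 0 ≤ K (z.1 - z.2) := (mul_nonneg (hΨ.nonneg _) hz.le).trans hle
    simp only [Pi.add_apply]
    by_cases h1 : z.1 ∈ B <;> by_cases h2 : z.2 ∈ B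
    · simp only [indicator_of_mem h1, indicator_of_mem h2]
      linarith
    · simp only [indicator_of_mem h1, indicator_of_notMem h2]
      linarith
    · simp only [indicator_of_notMem h1, indicator_of_mem h2]
      linarith
    · simp only [indicator_of_notMem h1, indicator_of_notMem h2, cone_eq_zero _ h1,
        cone_eq_zero _ h2, sub_self, hΨ.zero]
      simp

/-- Near zero the reaction dominates a power `t ^ (p μ)`. -/
theorem exists_reaction_lower_bound (hΨ : IsGamma p q Ψ) (hd : ∀ s, HasDerivAt Ψ (ψ s) s)
    (hq : 1 < q) (hqp : q ≤ p) (hf : ContinuousOn f (Ici 0)) (hμ0 : 0 < μ)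
    (hliminf : (0 : EReal) < liminf (fun t : ℝ => ((f t / Ψ t ^ μ : ℝ) : EReal)) (𝓝[>] 0)) :
    ∃ a δ : ℝ, 0 < a ∧ 0 < δ ∧ δ ≤ 1 ∧ ∀ t, 0 ≤ t → t < δ → a * t ^ (p * μ) ≤ f t := by
  obtain ⟨a, ha0, ha⟩ := EReal.lt_iff_exists_real_btwn.1 hliminf
  have ha0' : 0 < a := by exact_mod_cast ha0
  have hev := eventually_lt_of_lt_liminf ha
  obtain ⟨δ, hδ0, hδ⟩ := mem_nhdsGT_iff_exists_Ioo_subset.1 hev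
  have hδ0' : 0 < δ := hδ0
  have hpμ : 0 < p * μ := mul_pos (by linarith) hμ0
  have hpos : ∀ t, 0 < t → t < min δ 1 → a * t ^ (p * μ) ≤ f t := by
    intro t ht0 ht
    have h1 : (a : EReal) < ((f t / Ψ t ^ μ : ℝ) : EReal) :=
      hδ ⟨ht0, ht.trans_le (min_le_left _ _)⟩
    have h2 : a < f t / Ψ t ^ μ := by exact_mod_cast h1
    have h3 : 0 < Ψ t ^ μ := Real.rpow_pos_of_pos (hΨ.pos hq ht0.ne') _
    rw [lt_div_iff₀ h3] at h2
    have h4 : t ^ p ≤ Ψ t := by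
      simpa [hΨ.one] using hΨ.le_scale hd hq ht0 (ht.trans_le (min_le_right _ _)).le 1
    have h5 : t ^ (p * μ) ≤ Ψ t ^ μ := by
      rw [Real.rpow_mul ht0.le]
      exact Real.rpow_le_rpow (by positivity) h4 hμ0.le
    nlinarith
  refine ⟨a, min δ 1, ha0', lt_min hδ0' one_pos, min_le_right _ _, fun t ht0 ht => ?_⟩
  rcases eq_or_lt_of_le ht0 with rfl | ht0
  · -- At the origin the bound follows from the continuity of `f`.
    rw [Real.zero_rpow hpμ.ne', mul_zero]
    have h1 : Tendsto f (𝓝[>] 0) (𝓝 (f 0)) :=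
      (hf 0 self_mem_Ici).mono_left (nhdsWithin_mono _ Ioi_subset_Ici_self)
    refine ge_of_tendsto h1 ?_
    filter_upwards [Ioo_mem_nhdsGT (lt_min hδ0' one_pos)] with t ht
    have ht1 : 0 < t := ht.1
    exact le_trans (by positivity) (hpos t ht.1 ht.2)
  · exact hpos t ht0 ht

theorem le_primitiveG (hf : ContinuousOn f (Ici 0)) {a δ b : ℝ} (hb : 0 < b)
    (h : ∀ t, 0 ≤ t → t < δ → a * t ^ b ≤ f t) {t : ℝ} (ht0 : 0 ≤ t) (ht : t < δ) :
    a / (b + 1) * t ^ (b + 1) ≤ primitiveG f t := by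
  have hi : IntervalIntegrable (fun s => f |s|) volume 0 t :=
    (continuous_comp_abs hf).intervalIntegrable _ _
  have h1 : ∫ s in (0 : ℝ)..t, a * s ^ b = a / (b + 1) * t ^ (b + 1) := by
    rw [intervalIntegral.integral_const_mul, integral_rpow (Or.inl (by linarith)),
      Real.zero_rpow (by linarith)]
    ring
  rw [primitiveG_eq, abs_of_nonneg ht0, ← h1]
  refine intervalIntegral.integral_mono_on ht0
    ((Real.continuous_rpow_const hb.le).const_mul a |>.intervalIntegrable _ _) hi fun s hs => ?_
  rw [abs_of_nonneg hs.1]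
  exact h s hs.1 (hs.2.trans_lt ht)

/-- Small multiples `t χ` of a cone `χ` have negative energy: `E (t χ) = O(t ^ q)`, whereas
`∫ G (t χ)` is at least a multiple of `t ^ (p μ + 1)`, and `p μ + 1 < q`. -/
theorem exists_functionalI_neg (hJ : IsKernel J) (hΨ : IsGamma p q Ψ)
    (hd : ∀ s, HasDerivAt Ψ (ψ s) s) (hq : max (qStar J) 1 < q) (hqp : q ≤ p) (hΩo : IsOpen Ω)
    (hΩne : Ω.Nonempty) (hΩb : Bornology.IsBounded Ω) (hf : ContinuousOn f (Ici 0)) (hμ0 : 0 < μ)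
    (hμ : μ < (q - 1) / p) (hc : 0 ≤ c) (hg : ∀ t, 0 ≤ t → |f t| ≤ c * (1 + Ψ t ^ μ))
    (hliminf : (0 : EReal) < liminf (fun t : ℝ => ((f t / Ψ t ^ μ : ℝ) : EReal)) (𝓝[>] 0)) :
    ∃ v ∈ W₀ J Ψ Ω, functionalI J Ψ Ω f v < 0 := by
  have hcont := continuous_growth hd
  have hq1 : 1 < q := (le_max_right _ _).trans_lt hq
  have hp0 : 0 < p := by linarith
  obtain ⟨x₀, hx₀⟩ := hΩne
  obtain ⟨r', hr', hr'Ω⟩ := Metric.isOpen_iff.1 hΩo x₀ hx₀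
  set r : ℝ := min r' 1 with hr
  have hr0 : 0 < r := lt_min hr' one_pos
  have hball : Metric.ball x₀ r ⊆ Ω := (Metric.ball_subset_ball (min_le_left _ _)).trans hr'Ω
  set χ : Space N → ℝ := cone x₀ r with hχ
  have hχW : χ ∈ W₀ J Ψ Ω := cone_mem_W₀ hJ hΨ hd hq hr0 (min_le_right _ _) hball
  have hχ0 : ∀ x, 0 ≤ χ x := cone_nonneg x₀ r
  have hχ1 : ∀ x, χ x ≤ 1 := fun x => (cone_le x₀ hr0.le x).trans (min_le_right _ _)
  obtain ⟨a, δ, ha, hδ0, hδ1, hlow⟩ := exists_reaction_lower_bound hΨ hd hq1 hqp hf hμ0 hliminf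
  have hpμ : 0 < p * μ := mul_pos hp0 hμ0
  set m : ℝ := p * μ + 1 with hm
  have hmq : 0 < q - m := by
    rw [lt_div_iff₀ hp0] at hμ
    rw [hm]; linarith
  have hχc : Continuous fun x => χ x ^ m :=
    (continuous_cone x₀ r).rpow_const fun _ => Or.inr (by positivity)
  have hχi : IntegrableOn (fun x => χ x ^ m) Ω :=
    (integrableOn_const (C := (1 : ℝ)) hΩb.measure_lt_top.ne).mono'
      hχc.aestronglyMeasurable.restrict (Eventually.of_forall fun x => by
        rw [Real.norm_of_nonneg (Real.rpow_nonneg (hχ0 x) _)]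
        exact Real.rpow_le_one (hχ0 x) (hχ1 x) (by positivity))
  set b : ℝ := a / m * ∫ x in Ω, χ x ^ m with hb
  have hb0 : 0 < b := by
    refine mul_pos (by positivity) ?_
    rw [setIntegral_pos_iff_support_of_nonneg_ae
      (Eventually.of_forall fun x => Real.rpow_nonneg (hχ0 x) _) hχi]
    refine (Metric.measure_ball_pos volume x₀ hr0).trans_le (measure_mono fun x hx => ?_)
    refine ⟨(Real.rpow_pos_of_pos ?_ _).ne', hball hx⟩
    rw [mem_ball_iff_norm] at hx
    exact lt_max_of_lt_right (by linarith)
  set e : ℝ := (energyE J Ψ χ).toReal with he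
  have hvW : ∀ t : ℝ, 0 < t → t < δ → (fun x => t * χ x) ∈ W₀ J Ψ Ω := by
    intro t ht0 ht
    have h0W : (fun _ => 0 : Space N → ℝ) ∈ W₀ J Ψ Ω := by
      rw [mem_W₀_iff hJ hΨ hcont]
      simp [hΨ.zero]
    simpa using add_mul_mem_W₀ hJ hΨ hd hq1 h0W hχW
      (show |t| ≤ 1 by rw [abs_of_pos ht0]; linarith)
  have hI : ∀ t : ℝ, 0 < t → t < δ →
      functionalI J Ψ Ω f (fun x => t * χ x) ≤ t ^ m * (t ^ (q - m) * e - b) := by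
    intro t ht0 ht
    have ht1 : t ≤ 1 := by linarith
    have hχe := ((mem_W₀_iff hJ hΨ hcont).1 hχW).2.2.1
    have hve := ((mem_W₀_iff hJ hΨ hcont).1 (hvW t ht0 ht)).2.2.1
    have h1 : (energyE J Ψ fun x => t * χ x).toReal ≤ t ^ q * e := by
      rw [he, toReal_energyE hJ hΨ hcont (hvW t ht0 ht).1, toReal_energyE hJ hΨ hcont hχW.1]
      have : ∫ z : Space N × Space N, Ψ (t * χ z.1 - t * χ z.2) * J (z.1 - z.2) ≤
          ∫ z : Space N × Space N, t ^ q * (Ψ (χ z.1 - χ z.2) * J (z.1 - z.2)) := by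
        refine integral_mono_ae hve (hχe.const_mul _) ?_
        filter_upwards [hJ.ae_pair_pos] with z hz
        rw [← mul_sub, ← mul_assoc]
        exact mul_le_mul_of_nonneg_right (hΨ.scale_le hd hq1 ht0 ht1 _) hz.le
      rw [integral_const_mul] at this
      linarith
    have h2 : t ^ m * b ≤ ∫ x in Ω, primitiveG f (t * χ x) := by
      rw [show t ^ m * b = ∫ x in Ω, a / m * (t * χ x) ^ m by
        simp_rw [Real.mul_rpow ht0.le (hχ0 _)]
        rw [integral_const_mul, integral_const_mul, hb]; ring]
      refine setIntegral_mono ?_ (integrableOn_primitiveG hJ hΨ hd hq1 hqp hΩb hf hμ0 hμ hc hg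
        (hvW t ht0 ht)) fun x => ?_
      · simp_rw [Real.mul_rpow ht0.le (hχ0 _)]
        exact (hχi.const_mul _).const_mul _
      · exact le_primitiveG hf hpμ hlow (mul_nonneg ht0.le (hχ0 x))
          ((mul_le_of_le_one_right ht0.le (hχ1 x)).trans_lt ht)
    have h3 : t ^ q = t ^ m * t ^ (q - m) := by
      rw [← Real.rpow_add ht0]; congr 1; ring
    rw [functionalI]
    rw [h3] at h1
    linarith
  have hlim : Tendsto (fun t : ℝ => t ^ (q - m) * e - b) (𝓝[>] 0) (𝓝 (0 * e - b)) := by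
    have : Tendsto (fun t : ℝ => t ^ (q - m)) (𝓝[>] 0) (𝓝 0) := by
      have h := (Real.continuous_rpow_const hmq.le).tendsto 0
      rw [Real.zero_rpow hmq.ne'] at h
      exact h.mono_left nhdsWithin_le_nhds
    exact (this.mul_const e).sub_const b
  obtain ⟨t, ht, htδ⟩ := ((hlim.eventually_lt_const (show 0 * e - b < 0 by linarith)).and
    (Ioo_mem_nhdsGT hδ0)).exists
  exact ⟨_, hvW t htδ.1 htδ.2, (hI t htδ.1 htδ.2).trans_lt
    (mul_neg_of_pos_of_neg (Real.rpow_pos_of_pos htδ.1 _) ht)⟩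

end NegativeEnergy

/-! ### The Euler–Lagrange equation -/

section EulerLagrange

variable {N : ℕ} {p q μ c : ℝ} {J : Space N → ℝ} {ψ Ψ f : ℝ → ℝ} {Ω : Set (Space N)}

theorem IsGamma.abs_sub_le (hΨ : IsGamma p q Ψ) (hψ : IsNonlinearity ψ)
    (hd : ∀ s, HasDerivAt Ψ (ψ s) s) (hq : 1 < q) (hqp : q ≤ p) (a b : ℝ) {t : ℝ} (ht0 : 0 < t)
    (ht1 : t ≤ 1) : |Ψ (a + t * b) - Ψ a| ≤ t * (p * 2 ^ p * (Ψ a + Ψ b)) := by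
  set m : ℝ := |a| + |b| with hm
  have hm0 : 0 ≤ m := by positivity
  have htb : |t * b| ≤ |b| := by
    rw [abs_mul, abs_of_pos ht0]
    exact mul_le_of_le_one_left (abs_nonneg _) ht1
  have h1 : ‖Ψ (a + t * b) - Ψ a‖ ≤ ψ m * ‖(a + t * b) - a‖ := by
    refine (convex_Icc (-m) m).norm_image_sub_le_of_norm_hasDerivWithin_le
      (fun x _ => (hd x).hasDerivWithinAt) (fun x hx => ?_) ?_ ?_
    · rw [Real.norm_eq_abs, hψ.abs_map]
      exact hψ.monotone (abs_le.2 hx)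
    · exact abs_le.1 (by rw [hm]; linarith [abs_nonneg b])
    · exact abs_le.1 ((abs_add_le _ _).trans (by rw [hm]; linarith))
  have h2 : m * ψ m ≤ p * (2 ^ p * (Ψ a + Ψ b)) := by
    refine (hΨ.mul_deriv_le hd hq m).trans (mul_le_mul_of_nonneg_left ?_ (by linarith))
    simpa [hΨ.map_abs] using hΨ.add_le hd hq |a| |b|
  rw [Real.norm_eq_abs, Real.norm_eq_abs, add_sub_cancel_left, abs_mul, abs_of_pos ht0] at h1
  have h3 : |b| * ψ m ≤ m * ψ m :=
    mul_le_mul_of_nonneg_right (by rw [hm]; linarith [abs_nonneg a]) (hψ.nonneg hm0)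
  have h4 := mul_le_mul_of_nonneg_left (h3.trans h2) ht0.le
  linarith

theorem aemeasurable_interaction (hJ : IsKernel J) (hψ : IsNonlinearity ψ) {u φ : Space N → ℝ}
    (hu : AEMeasurable u) (hφ : AEMeasurable φ) : AEMeasurable (interactionIntegrand J ψ u φ) :=
  ((hψ.continuous.measurable.comp_aemeasurable (aemeasurable_pair_diff hu)).mul
    (aemeasurable_pair_diff hφ)).mul hJ.aemeasurable_pair

theorem integrable_interaction (hJ : IsKernel J) (hψ : IsNonlinearity ψ) (hΨ : IsGamma p q Ψ)
    (hd : ∀ s, HasDerivAt Ψ (ψ s) s) (hq : 1 < q) (hqp : q ≤ p) {u φ : Space N → ℝ}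
    (hu : u ∈ W₀ J Ψ Ω) (hφ : φ ∈ W₀ J Ψ Ω) : Integrable (interactionIntegrand J ψ u φ) := by
  have h1 := ((mem_W₀_iff hJ hΨ (continuous_growth hd)).1 hu).2.2.1
  have h2 := ((mem_W₀_iff hJ hΨ (continuous_growth hd)).1 hφ).2.2.1
  refine ((h1.add h2).const_mul p).mono'
    (aemeasurable_interaction hJ hψ hu.1 hφ.1).aestronglyMeasurable ?_
  filter_upwards [hJ.ae_pair_pos] with z hz
  rw [interactionIntegrand, norm_mul, Real.norm_of_nonneg hz.le, Real.norm_eq_abs]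
  have := mul_le_mul_of_nonneg_right
    (hΨ.abs_deriv_mul_le hψ hd hq hqp (u z.1 - u z.2) (φ z.1 - φ z.2)) hz.le
  simp only [Pi.add_apply]
  linarith

theorem tendsto_energy_quotient (hJ : IsKernel J) (hψ : IsNonlinearity ψ) (hΨ : IsGamma p q Ψ)
    (hd : ∀ s, HasDerivAt Ψ (ψ s) s) (hq : 1 < q) (hqp : q ≤ p) {u φ : Space N → ℝ}
    (hu : u ∈ W₀ J Ψ Ω) (hφ : φ ∈ W₀ J Ψ Ω) :
    Tendsto (fun t : ℝ => t⁻¹ * ((energyE J Ψ fun x => u x + t * φ x).toReal -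
      (energyE J Ψ u).toReal)) (𝓝[>] 0) (𝓝 (interaction J ψ u φ)) := by
  have hc := continuous_growth hd
  have h1 := ((mem_W₀_iff hJ hΨ hc).1 hu).2.2.1
  have h2 := ((mem_W₀_iff hJ hΨ hc).1 hφ).2.2.1
  have hmem : ∀ᶠ t : ℝ in 𝓝[>] 0, 0 < t ∧ t ≤ 1 :=
    mem_of_superset (Ioc_mem_nhdsGT one_pos) fun t ht => ht
  let X : ℝ → Space N × Space N → ℝ := fun t z => t⁻¹ *
    (Ψ ((u z.1 - u z.2) + t * (φ z.1 - φ z.2)) * J (z.1 - z.2) - Ψ (u z.1 - u z.2) * J (z.1 - z.2))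
  have hlim : Tendsto (fun t => ∫ z, X t z) (𝓝[>] 0)
      (𝓝 (∫ z, interactionIntegrand J ψ u φ z)) := by
    refine tendsto_integral_filter_of_dominated_convergence
      (fun z => p * 2 ^ p * (Ψ (u z.1 - u z.2) * J (z.1 - z.2) + Ψ (φ z.1 - φ z.2) * J (z.1 - z.2)))
      (Eventually.of_forall fun t => ?_) ?_ ((h1.add h2).const_mul _)
      (Eventually.of_forall fun z => ?_)
    · have hm : AEMeasurable fun z : Space N × Space N =>
          Ψ ((u z.1 - u z.2) + t * (φ z.1 - φ z.2)) :=
        hc.measurable.comp_aemeasurable ((aemeasurable_pair_diff hu.1).add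
          ((aemeasurable_pair_diff hφ.1).const_mul t))
      exact (((hm.mul hJ.aemeasurable_pair).sub
        (aemeasurable_energy hJ hc hu.1)).const_mul _).aestronglyMeasurable
    · filter_upwards [hmem] with t ht
      filter_upwards [hJ.ae_pair_pos] with z hz
      have h3 := mul_le_mul_of_nonneg_right (hΨ.abs_sub_le hψ hd hq hqp (u z.1 - u z.2)
        (φ z.1 - φ z.2) ht.1 ht.2) hz.le
      simp only [X]
      rw [← sub_mul, norm_mul, norm_mul, Real.norm_of_nonneg (inv_pos.2 ht.1).le,
        Real.norm_of_nonneg hz.le, Real.norm_eq_abs, inv_mul_le_iff₀ ht.1]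
      linarith
    · have h3 : HasDerivAt (fun t : ℝ => Ψ ((u z.1 - u z.2) + t * (φ z.1 - φ z.2)))
          (ψ (u z.1 - u z.2) * (φ z.1 - φ z.2)) 0 := by
        have h4 : HasDerivAt (fun t : ℝ => (u z.1 - u z.2) + t * (φ z.1 - φ z.2))
            (φ z.1 - φ z.2) 0 := by
          simpa using ((hasDerivAt_id (0 : ℝ)).mul_const (φ z.1 - φ z.2)).const_add (u z.1 - u z.2)
        have h5 := hd ((u z.1 - u z.2) + 0 * (φ z.1 - φ z.2))
        have h6 := HasDerivAt.comp (0 : ℝ) h5 h4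
        rwa [zero_mul, add_zero] at h6
      have h6 := h3.tendsto_slope_zero_right.mul_const (J (z.1 - z.2))
      simp only [zero_add, zero_mul, add_zero, smul_eq_mul] at h6
      refine h6.congr fun t => ?_
      simp only [X]
      ring
  refine (hlim.const_mul (1 / 2)).congr' ?_
  filter_upwards [hmem] with t ht
  have hut := add_mul_mem_W₀ hJ hΨ hd hq hu hφ (show |t| ≤ 1 by rw [abs_of_pos ht.1]; exact ht.2)
  have h3 := ((mem_W₀_iff hJ hΨ hc).1 hut).2.2.1
  have h4 : ∀ z : Space N × Space N, (u z.1 - u z.2) + t * (φ z.1 - φ z.2) =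
      (u z.1 + t * φ z.1) - (u z.2 + t * φ z.2) := fun z => by ring
  simp only [X, h4]
  rw [integral_const_mul, integral_sub h3 h1, toReal_energyE hJ hΨ hc hut.1,
    toReal_energyE hJ hΨ hc hu.1]
  ring

/-- The right derivative at `t = 0` of `|u + t φ|`, for `u ≥ 0`. -/
noncomputable def absDirection (u φ : Space N → ℝ) (x : Space N) : ℝ :=
  if u x = 0 then |φ x| else φ x

theorem abs_absDirection (u φ : Space N → ℝ) (x : Space N) : |absDirection u φ x| = |φ x| := by
  unfold absDirection
  split_ifs <;> simp

theorem aemeasurable_absDirection {u φ : Space N → ℝ} (hu : AEMeasurable u)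
    (hφ : AEMeasurable φ) : AEMeasurable (absDirection u φ) := by
  have h : Measurable fun s : ℝ × ℝ => if s.1 = 0 then |s.2| else s.2 :=
    Measurable.ite (measurable_fst (measurableSet_singleton 0)) measurable_snd.abs measurable_snd
  exact h.comp_aemeasurable (hu.prodMk hφ)

/-- Bound for the reaction against a test function of the same size as `φ`. -/
theorem exists_reaction_dominating (hJ : IsKernel J) (hΨ : IsGamma p q Ψ)
    (hd : ∀ s, HasDerivAt Ψ (ψ s) s) (hq : 1 < q) (hqp : q ≤ p)
    (hΩb : Bornology.IsBounded Ω) (hμ0 : 0 < μ) (hμ : μ < (q - 1) / p) (hc : 0 ≤ c)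
    {u φ : Space N → ℝ} (hu : u ∈ W₀ J Ψ Ω) (hφ : φ ∈ W₀ J Ψ Ω) :
    ∃ H : Space N → ℝ, IntegrableOn H Ω ∧
      ∀ x, c * (1 + Ψ (|u x| + |φ x|) ^ μ) * |φ x| ≤ H x := by
  have hcont := continuous_growth hd
  obtain ⟨C, -, hC⟩ := hΨ.subcritical hd hq hqp hμ0 hμ hc one_pos
  have h1 := ((mem_W₀_iff hJ hΨ hcont).1 hu).2.1
  have h2 := ((mem_W₀_iff hJ hΨ hcont).1 hφ).2.1
  refine ⟨fun x => 2 ^ p * (Ψ (u x) + Ψ (φ x)) + C,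
    ((h1.add h2).const_mul _).integrableOn.add (integrableOn_const (C := C) hΩb.measure_lt_top.ne),
    fun x => ?_⟩
  have h3 := hC (|u x| + |φ x|)
  have h4 : Ψ (|u x| + |φ x|) ≤ 2 ^ p * (Ψ (u x) + Ψ (φ x)) := by
    simpa [hΨ.map_abs] using hΨ.add_le hd hq |u x| |φ x|
  have h5 : 0 ≤ c * (1 + Ψ (|u x| + |φ x|) ^ μ) :=
    mul_nonneg hc (by linarith [Real.rpow_nonneg (hΨ.nonneg (|u x| + |φ x|)) μ])
  have h6 := mul_le_mul_of_nonneg_left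
    (show |φ x| ≤ |(|u x| + |φ x|)| from
      (le_add_of_nonneg_left (abs_nonneg _)).trans (le_abs_self _)) h5
  linarith

theorem integrableOn_reaction (hJ : IsKernel J) (hΨ : IsGamma p q Ψ)
    (hd : ∀ s, HasDerivAt Ψ (ψ s) s) (hq : 1 < q) (hqp : q ≤ p)
    (hΩb : Bornology.IsBounded Ω) (hf : ContinuousOn f (Ici 0)) (hμ0 : 0 < μ)
    (hμ : μ < (q - 1) / p) (hc : 0 ≤ c) (hg : ∀ t, 0 ≤ t → |f t| ≤ c * (1 + Ψ t ^ μ))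
    {u φ θ : Space N → ℝ} (hu : u ∈ W₀ J Ψ Ω) (hu0 : ∀ x, 0 ≤ u x) (hφ : φ ∈ W₀ J Ψ Ω)
    (hθ : AEMeasurable θ) (hθφ : ∀ x, |θ x| = |φ x|) :
    IntegrableOn (fun x => f (u x) * θ x) Ω := by
  obtain ⟨H, hH, hle⟩ := exists_reaction_dominating hJ hΨ hd hq hqp hΩb hμ0 hμ hc hu hφ
  have hm : AEMeasurable fun x => f (u x) := by
    have := (continuous_comp_abs hf).measurable.comp_aemeasurable hu.1
    refine this.congr (Eventually.of_forall fun x => ?_)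
    simp only [Function.comp_apply, abs_of_nonneg (hu0 x)]
  refine hH.mono' (hm.mul hθ).aestronglyMeasurable.restrict (Eventually.of_forall fun x => ?_)
  refine le_trans ?_ (hle x)
  rw [norm_mul, Real.norm_eq_abs, Real.norm_eq_abs, hθφ]
  refine mul_le_mul_of_nonneg_right ?_ (abs_nonneg _)
  have := abs_reaction_le hΨ hμ0 hc hg (s := u x) (m := |u x| + |φ x|)
    ((le_add_of_nonneg_right (abs_nonneg _)).trans (le_abs_self _))
  rwa [abs_of_nonneg (hu0 x)] at this ⊢

/-- The one-sided derivative of the reaction at `u ≥ 0`; the corner of the even function `G` at the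
origin makes it nonlinear in `φ`. -/
theorem tendsto_reaction_quotient (hJ : IsKernel J) (hΨ : IsGamma p q Ψ)
    (hd : ∀ s, HasDerivAt Ψ (ψ s) s) (hq : 1 < q) (hqp : q ≤ p)
    (hΩb : Bornology.IsBounded Ω) (hf : ContinuousOn f (Ici 0)) (hμ0 : 0 < μ)
    (hμ : μ < (q - 1) / p) (hc : 0 ≤ c) (hg : ∀ t, 0 ≤ t → |f t| ≤ c * (1 + Ψ t ^ μ))
    {u φ : Space N → ℝ} (hu : u ∈ W₀ J Ψ Ω) (hu0 : ∀ x, 0 ≤ u x) (hφ : φ ∈ W₀ J Ψ Ω) :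
    Tendsto (fun t : ℝ => t⁻¹ * ((∫ x in Ω, primitiveG f (u x + t * φ x)) -
      ∫ x in Ω, primitiveG f (u x))) (𝓝[>] 0)
      (𝓝 (∫ x in Ω, f (u x) * absDirection u φ x)) := by
  obtain ⟨H, hH, hle⟩ := exists_reaction_dominating hJ hΨ hd hq hqp hΩb hμ0 hμ hc hu hφ
  have hmem : ∀ᶠ t : ℝ in 𝓝[>] 0, 0 < t ∧ t ≤ 1 :=
    mem_of_superset (Ioc_mem_nhdsGT one_pos) fun t ht => ht
  have hGm : ∀ v : Space N → ℝ, AEMeasurable v → AEMeasurable fun x => primitiveG f (v x) :=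
    fun v hv => (continuous_primitiveG hf).measurable.comp_aemeasurable hv
  have hlim : Tendsto (fun t : ℝ => ∫ x in Ω, t⁻¹ * (primitiveG f (u x + t * φ x) -
      primitiveG f (u x))) (𝓝[>] 0) (𝓝 (∫ x in Ω, f (u x) * absDirection u φ x)) := by
    refine tendsto_integral_filter_of_dominated_convergence H
      (Eventually.of_forall fun t => ?_) ?_ hH (Eventually.of_forall fun x => ?_)
    · exact (((hGm _ (hu.1.add (hφ.1.const_mul t))).sub
        (hGm _ hu.1)).const_mul _).aestronglyMeasurable.restrict
    · filter_upwards [hmem] with t ht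
      refine Eventually.of_forall fun x => ?_
      have htφ : |t * φ x| ≤ |φ x| := by
        rw [abs_mul, abs_of_pos ht.1]
        exact mul_le_of_le_one_left (abs_nonneg _) ht.2
      have hm : |(|u x| + |φ x|)| = |u x| + |φ x| := abs_of_nonneg (by positivity)
      have h1 := abs_primitiveG_sub_le hΨ hf hμ0 hc hg (s := u x + t * φ x) (t := u x)
        (m := |u x| + |φ x|) (by rw [hm]; exact (abs_add_le _ _).trans (by linarith))
        (by rw [hm]; linarith [abs_nonneg (φ x)])
      rw [add_sub_cancel_left, abs_mul, abs_of_pos ht.1] at h1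
      rw [norm_mul, Real.norm_of_nonneg (inv_pos.2 ht.1).le, Real.norm_eq_abs,
        inv_mul_le_iff₀ ht.1]
      have h2 := mul_le_mul_of_nonneg_left (hle x) ht.1.le
      linarith
    · set b : ℝ := absDirection u φ x with hb
      have h1 : HasDerivAt (fun t : ℝ => ∫ s in (0 : ℝ)..(u x + t * b), f |s|) (f (u x) * b) 0 := by
        have h2 : HasDerivAt (fun t : ℝ => u x + t * b) b 0 := by
          simpa using ((hasDerivAt_id (0 : ℝ)).mul_const b).const_add (u x)
        have h3 := hasDerivAt_primitive hf (u x + 0 * b)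
        have h4 := HasDerivAt.comp (0 : ℝ) h3 h2
        rwa [zero_mul, add_zero, abs_of_nonneg (hu0 x)] at h4
      have h4 := h1.tendsto_slope_zero_right
      simp only [zero_add, zero_mul, add_zero, smul_eq_mul] at h4
      refine h4.congr' ?_
      have h5 : ∀ᶠ t : ℝ in 𝓝[>] 0, |u x + t * φ x| = u x + t * b := by
        by_cases hx : u x = 0
        · filter_upwards [hmem] with t ht
          rw [hb, absDirection, if_pos hx, hx, zero_add, zero_add, abs_mul, abs_of_pos ht.1]
        · have hux : 0 < u x + 0 * φ x := by
            simpa using (hu0 x).lt_of_ne (Ne.symm hx)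
          have h6 : Tendsto (fun t : ℝ => u x + t * φ x) (𝓝[>] 0) (𝓝 (u x + 0 * φ x)) :=
            Tendsto.mono_left (Continuous.tendsto (by fun_prop) 0) nhdsWithin_le_nhds
          filter_upwards [h6.eventually_const_lt hux] with t ht
          rw [hb, absDirection, if_neg hx, abs_of_pos ht]
      filter_upwards [h5] with t ht
      rw [primitiveG_eq, primitiveG_eq, ht, abs_of_nonneg (hu0 x)]
  refine hlim.congr' ?_
  filter_upwards [hmem] with t ht
  have hut := add_mul_mem_W₀ hJ hΨ hd hq hu hφ (show |t| ≤ 1 by rw [abs_of_pos ht.1]; exact ht.2)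
  rw [integral_const_mul, integral_sub
    (integrableOn_primitiveG hJ hΨ hd hq hqp hΩb hf hμ0 hμ hc hg hut)
    (integrableOn_primitiveG hJ hΨ hd hq hqp hΩb hf hμ0 hμ hc hg hu)]

theorem neg_mem_W₀ (hJ : IsKernel J) (hΨ : IsGamma p q Ψ) (hc : Continuous Ψ)
    {φ : Space N → ℝ} (hφ : φ ∈ W₀ J Ψ Ω) : (fun x => -φ x) ∈ W₀ J Ψ Ω :=
  mem_W₀_of_le hJ hΨ hc hφ hφ hφ.1.neg 1
    (fun x => by rw [hΨ.symm]; linarith [hΨ.nonneg (φ x)])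
    (fun x y => by
      rw [show -φ x - -φ y = -(φ x - φ y) by ring, hΨ.symm]; linarith [hΨ.nonneg (φ x - φ y)])
    (fun x h _ => by simp [h])

/-- A nonnegative minimizer solves the equation. Where `u = 0` the functional is only one-sidedly
differentiable, with slope `f 0 * |φ|`. As `f 0 ≥ 0`, comparing the directions `φ` and `-φ` shows
that `f 0 * |φ|` vanishes almost everywhere there. -/
theorem weak_eq_of_minimizer (hJ : IsKernel J) (hψ : IsNonlinearity ψ) (hΨ : IsGamma p q Ψ)
    (hd : ∀ s, HasDerivAt Ψ (ψ s) s) (hq : 1 < q) (hqp : q ≤ p)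
    (hΩb : Bornology.IsBounded Ω) (hf : ContinuousOn f (Ici 0)) (hf0 : 0 ≤ f 0) (hμ0 : 0 < μ)
    (hμ : μ < (q - 1) / p) (hc : 0 ≤ c) (hg : ∀ t, 0 ≤ t → |f t| ≤ c * (1 + Ψ t ^ μ))
    {u : Space N → ℝ} (hu : u ∈ W₀ J Ψ Ω) (hu0 : ∀ x, 0 ≤ u x)
    (hmin : ∀ v ∈ W₀ J Ψ Ω, functionalI J Ψ Ω f u ≤ functionalI J Ψ Ω f v)
    {φ : Space N → ℝ} (hφ : φ ∈ W₀ J Ψ Ω) :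
    interaction J ψ u φ = ∫ x in Ω, f (u x) * φ x := by
  have key : ∀ θ ∈ W₀ J Ψ Ω, ∫ x in Ω, f (u x) * absDirection u θ x ≤ interaction J ψ u θ := by
    intro θ hθ
    refine sub_nonneg.1 (ge_of_tendsto ((tendsto_energy_quotient hJ hψ hΨ hd hq hqp hu hθ).sub
      (tendsto_reaction_quotient hJ hΨ hd hq hqp hΩb hf hμ0 hμ hc hg hu hu0 hθ)) ?_)
    filter_upwards [Ioc_mem_nhdsGT (one_pos : (0 : ℝ) < 1)] with t ht
    have h1 := hmin _ (add_mul_mem_W₀ hJ hΨ hd hq hu hθ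
      (show |t| ≤ 1 by rw [abs_of_pos ht.1]; exact ht.2))
    rw [functionalI, functionalI] at h1
    rw [← mul_sub]
    exact mul_nonneg (inv_pos.2 ht.1).le (by linarith)
  have hφ' := neg_mem_W₀ hJ hΨ (continuous_growth hd) hφ
  have hi := fun (θ : Space N → ℝ) (hθ : θ ∈ W₀ J Ψ Ω) =>
    integrableOn_reaction hJ hΨ hd hq hqp hΩb hf hμ0 hμ hc hg hu hu0 hθ
      (aemeasurable_absDirection hu.1 hθ.1) (abs_absDirection u θ)
  have h1 := key φ hφ
  have h2 := key _ hφ'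
  have hneg : interaction J ψ u (fun x => -φ x) = -interaction J ψ u φ := by
    rw [interaction, interaction, ← mul_neg, ← integral_neg]
    congr 2 with z
    simp only [interactionIntegrand]
    ring
  have hpt : ∀ x, 0 ≤ f (u x) * absDirection u φ x +
      f (u x) * absDirection u (fun x => -φ x) x := by
    intro x
    by_cases hx : u x = 0
    · have h3 := mul_nonneg hf0 (abs_nonneg (φ x))
      simp only [absDirection, hx, if_true, abs_neg]
      exact add_nonneg h3 h3
    · simp [absDirection, if_neg hx]
  have hzero : ∫ x in Ω, (f (u x) * absDirection u φ x +
      f (u x) * absDirection u (fun x => -φ x) x) = 0 := by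
    refine le_antisymm ?_ (integral_nonneg hpt)
    rw [integral_add (hi φ hφ) (hi _ hφ')]
    linarith
  have hae := (integral_eq_zero_iff_of_nonneg hpt ((hi φ hφ).add (hi _ hφ'))).1 hzero
  have hvan : ∀ᵐ x ∂volume.restrict Ω, f (u x) * absDirection u φ x = f (u x) * φ x ∧
      f (u x) * absDirection u (fun x => -φ x) x = -(f (u x) * φ x) := by
    filter_upwards [hae] with x hx
    by_cases hux : u x = 0
    · simp only [absDirection, if_pos hux, abs_neg, Pi.zero_apply] at hx ⊢
      have h3 : f (u x) * |φ x| = 0 := by linarith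
      have h4 : f (u x) * φ x = 0 := by
        rcases mul_eq_zero.1 h3 with h | h
        · rw [h, zero_mul]
        · rw [abs_eq_zero.1 h, mul_zero]
      rw [h3, h4, neg_zero]
      exact ⟨rfl, rfl⟩
    · simp [absDirection, if_neg hux]
  rw [integral_congr_ae (hvan.mono fun x hx => hx.1)] at h1
  rw [integral_congr_ae (hvan.mono fun x hx => hx.2), integral_neg, hneg] at h2
  linarith

end EulerLagrange

end NonlocalOrlicz

open NonlocalOrlicz in
theorem theorem5p1 {N : ℕ} (J : Space N → ℝ) (hJ : IsKernel J)
    (p q : ℝ) (hqp : q ≤ p) (hq : max (qStar J) 1 < q)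
    (ψ Ψ : ℝ → ℝ) (hψ : IsNonlinearity ψ) (hΨψ : ∀ s, HasDerivAt Ψ (ψ s) s)
    (hΨ : IsGamma p q Ψ)
    (Ω : Set (Space N)) (hΩo : IsOpen Ω) (hΩne : Ω.Nonempty) (hΩb : Bornology.IsBounded Ω)
    (f : ℝ → ℝ) (hf : ContinuousOn f (Set.Ici 0))
    (μ : ℝ) (hμ0 : 0 < μ) (hμ : μ < (q - 1) / p)
    (hgrowth : ∃ c₁ c₂ : ℝ, ∀ t, 0 ≤ t → |f t| ≤ c₁ + c₂ * Ψ t ^ μ)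
    (hliminf : (0 : EReal) < liminf (fun t : ℝ => ((f t / Ψ t ^ μ : ℝ) : EReal)) (𝓝[>] 0)) :
    ∃ u : Space N → ℝ, IsSolution J Ψ ψ Ω f u ∧
      (∀ v ∈ W₀ J Ψ Ω, IntegrableOn (fun x => primitiveG f (v x)) Ω volume ∧
        functionalI J Ψ Ω f u ≤ functionalI J Ψ Ω f v) ∧
      functionalI J Ψ Ω f u < 0 := by
  have hq1 : 1 < q := (le_max_right _ _).trans_lt hq
  obtain ⟨c₁, c₂, hc₁₂⟩ := hgrowth
  obtain ⟨c, hc, hg⟩ : ∃ c : ℝ, 0 ≤ c ∧ ∀ t, 0 ≤ t → |f t| ≤ c * (1 + Ψ t ^ μ) := by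
    refine ⟨|c₁| + |c₂|, by positivity, fun t ht => (hc₁₂ t ht).trans ?_⟩
    have h1 : 0 ≤ Ψ t ^ μ := Real.rpow_nonneg (hΨ.nonneg t) μ
    nlinarith [le_abs_self c₁, mul_le_mul_of_nonneg_right (le_abs_self c₂) h1, abs_nonneg c₂,
      mul_nonneg (abs_nonneg c₁) h1]
  obtain ⟨u, hu, hu0, hmin⟩ :=
    exists_minimizer hJ hΨ hΨψ hq1 hqp hΩo hΩb hf hμ0 hμ hc hg
  obtain ⟨v, hv, hvneg⟩ :=
    exists_functionalI_neg hJ hΨ hΨψ hq hqp hΩo hΩne hΩb hf hμ0 hμ hc hg hliminf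
  have hneg : functionalI J Ψ Ω f u < 0 := (hmin v hv).trans_lt hvneg
  have hf0 : 0 ≤ f 0 := by
    obtain ⟨a, δ, ha, hδ, -, hlow⟩ :=
      exists_reaction_lower_bound hΨ hΨψ hq1 hqp hf hμ0 hliminf
    exact le_trans (by positivity) (hlow 0 le_rfl hδ)
  refine ⟨u, ⟨hu, Filter.Eventually.of_forall hu0, fun h0 => ?_, fun φ hφ => ?_, fun φ hφ => ?_,
    fun φ hφ => ?_⟩, fun w hw => ⟨?_, hmin w hw⟩, hneg⟩
  · -- If `u` vanished, the reaction would contribute nothing and the energy would be nonnegative.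
    have h1 : ∫ x in Ω, primitiveG f (u x) = 0 := by
      rw [integral_congr_ae (g := fun _ => (0 : ℝ)) (h0.mono fun x hx => by
        simp [hx, primitiveG_zero]), integral_zero]
    rw [functionalI, h1, sub_zero] at hneg
    exact absurd ENNReal.toReal_nonneg hneg.not_ge
  · exact integrable_interaction hJ hψ hΨ hΨψ hq1 hqp hu hφ
  · exact integrableOn_reaction hJ hΨ hΨψ hq1 hqp hΩb hf hμ0 hμ hc hg hu hu0 hφ hφ.1 fun _ => rfl
  · exact weak_eq_of_minimizer hJ hψ hΨ hΨψ hq1 hqp hΩb hf hf0 hμ0 hμ hc hg hu hu0 hmin hφ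
  · exact integrableOn_primitiveG hJ hΨ hΨψ hq1 hqp hΩb hf hμ0 hμ hc hg hw
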